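/- All vector spaces are over $\mathbb{C}$. Let $G=\{\alpha x+\beta : \alpha\in\mathbb{C}^\times,\ \beta\in\mathbb{C}\}$, a group under composition, and let $\Phi:G\to\mathbb{C}^\times$, $\Phi(\alpha x+\beta)=\alpha$. For $g(x)=\alpha x+\beta\in G$ and $n\in\mathbb{Z}$ read $g(x)^n=\sum_{i\ge 0}\binom{n}{i}\alpha^{n-i}\beta^i x^{n-i}\in\mathbb{C}((x^{-1}))$, put $x_1^{-1}\delta\!\left(\frac{g(x_2)}{x_1}\right)=\sum_{n\in\mathbb{Z}}x_1^{-n-1}g(x_2)^n$, and for $a(x)=\sum_n a_n x^{-n-1}\in \mathrm{Hom}(W,W((x^{-1})))$ put $a(g(x))=\sum_n a_n\, g(x)^{-n-1}$. Let $\Gamma$ be a group. A *vertex $\Gamma$-algebra* is a vertex algebra $(V,Y,\mathbf 1)$, $Y(u,x)=\sum_{n\in\mathbb{Z}}u_nx^{-n-1}$, with group homomorphisms $L:\Gamma\to GL(V)$ and $\phi:\Gamma\to\mathbb{C}^\times$ such that $L(g)\mathbf 1=\mathbf 1$ and $L(g)Y(u,x)v=Y(L(g)u,\phi(g)x)L(g)v$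 for $g\in\Gamma$, $u,v\in V$. A *quasi module at infinity* for a vertex $\Gamma$-algebra $V$ is a vector space $W$ with a linear map $Y_W(\cdot,x):V\to\mathrm{Hom}(W,W((x^{-1})))$ and a group homomorphism $\Psi:\Gamma\to G$ such that: 1. $Y_W(\mathbf 1,x)=1_W$; 2. for all $u,v\in V$ there is a nonzero polynomial $p(x_1,x_2)$ with $p(x_1,x_2)Y_W(u,x_1)Y_W(v,x_2)\in\mathrm{Hom}(W,W((x_1^{-1},x_2^{-1})))$ and $$\bigl(p(x_1,x_2)Y_W(u,x_1)Y_W(v,x_2)\bigr)\big|_{x_1=x_2+x_0}=p(x_0+x_2,x_2)\,Y_W(Y(u,x_0)v,x_2);$$ 3. $\phi=\Phi\circ\Psi$, and $Y_W(L(g)v,x)=Y_W(v,\Psi(g)^{-1}(x))$ for $g\in\Gamma$, $v\in V$; 4. for all $u,v\in V$ there is a product $q(x_1,x_2)$ of polynomials $x_1-g(x_2)$ with $g\in\Psi(\Gamma)$ (repetitions allowed) such that $q(x_1,x_2)[Y_W(u,x_1),Y_W(v,x_2)]=0$. **Theorem.** Let $V$ be a vertex $\Gamma$-algebra with homomorphisms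 $L$ and $\phi$, let $(W,Y_W)$ be a quasi $V$-module at infinity with homomorphism $\Psi:\Gamma\to G$, and let $u,v\in V$. Then there exist finitely many $\sigma_1,\dots,\sigma_r\in\Gamma$ (with $r\ge 0$) such that $\Psi(\sigma_1),\dots,\Psi(\sigma_r)$ are distinct and $$[Y_W(u,x_1),Y_W(v,x_2)]=-\sum_{i=1}^{r}\sum_{j\ge 0}\phi(\sigma_i)^{-1}\,Y_W\bigl((L(\sigma_i)u)_j v,x_2\bigr)\frac{1}{j!}\left(\frac{\partial}{\partial x_2}\right)^{j}x_1^{-1}\delta\!\left(\frac{\Psi(\sigma_i)^{-1}(x_2)}{x_1}\right).$$ Furthermore, if $\Psi$ is injective, then $$[Y_W(u,x_1),Y_W(v,x_2)]=-\sum_{\sigma\in\Gamma}\sum_{j\ge 0}\phi(\sigma)^{-1}\,Y_W\bigl((L(\sigma)u)_j v,x_2\bigr)\frac{1}{j!}\left(\frac{\partial}{\partial x_2}\right)^{j}x_1^{-1}\delta\!\left(\frac{\Psi(\sigma)^{-1}(x_2)}{x_1}\right),$$ where only finitely many terms (indexed by pairs $(\sigma,j)$) are nonzero. -/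

import Mathlib

noncomputable section

/-! ### The group `G` of linear polynomials under composition -/

/-- A polynomial `a x + b` over `ℂ` with `a ≠ 0`. -/
@[ext]
structure LinPoly where
  a : ℂˣ
  b : ℂ

namespace LinPoly

/-- The value `g(x) = a x + b`. -/
def eval (g : LinPoly) (x : ℂ) : ℂ := (g.a : ℂ) * x + g.b

/-- The product is the composition: `(g * h)(x) = g(h(x))`. -/
instance : Mul LinPoly := ⟨fun g h => ⟨g.a * h.a, (g.a : ℂ) * h.b + g.b⟩⟩

/-- The identity is the polynomial `x`. -/
instance : One LinPoly := ⟨⟨1, 0⟩⟩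

/-- The compositional inverse `a⁻¹ x - a⁻¹ b`. -/
instance : Inv LinPoly := ⟨fun g => ⟨g.a⁻¹, -(((g.a⁻¹ : ℂˣ) : ℂ) * g.b)⟩⟩

@[simp] theorem mul_a (g h : LinPoly) : (g * h).a = g.a * h.a := rfl
@[simp] theorem mul_b (g h : LinPoly) : (g * h).b = (g.a : ℂ) * h.b + g.b := rfl
@[simp] theorem one_a : (1 : LinPoly).a = 1 := rfl
@[simp] theorem one_b : (1 : LinPoly).b = 0 := rfl
@[simp] theorem inv_a (g : LinPoly) : (g⁻¹).a = g.a⁻¹ := rfl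
@[simp] theorem inv_b (g : LinPoly) : (g⁻¹).b = -(((g.a⁻¹ : ℂˣ) : ℂ) * g.b) := rfl

instance : Group LinPoly :=
  Group.ofLeftAxioms
    (fun g h k => by
      ext
      · simp [mul_assoc]
      · simp only [mul_b, mul_a, Units.val_mul]; ring)
    (fun g => by ext <;> simp)
    (fun g => by ext <;> simp)

theorem eval_mul (g h : LinPoly) (x : ℂ) : (g * h).eval x = g.eval (h.eval x) := by
  simp only [eval, mul_a, mul_b, Units.val_mul]; ring

theorem eval_one (x : ℂ) : (1 : LinPoly).eval x = x := by simp [eval]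

/-- The homomorphism `Φ : G → ℂˣ`, `a x + b ↦ a`. -/
def leading : LinPoly →* ℂˣ where
  toFun := LinPoly.a
  map_one' := rfl
  map_mul' _ _ := rfl

end LinPoly

/-! ### Formal series in `x⁻¹`

A formal series `∑ c_n x ^ n` (`n` running over `ℤ`) is the function `n ↦ c_n`. -/

/-- `ℂ((x⁻¹))`: the scalar series involving only powers of `x` that are bounded above. -/
def LaurentInf : Submodule ℂ (ℤ → ℂ) where
  carrier := {f | ∃ N : ℤ, ∀ n, N < n → f n = 0}
  add_mem' := by
    rintro f g ⟨N, hN⟩ ⟨M, hM⟩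
    refine ⟨max N M, fun n hn => ?_⟩
    simp [hN n (lt_of_le_of_lt (le_max_left _ _) hn),
      hM n (lt_of_le_of_lt (le_max_right _ _) hn)]
  zero_mem' := ⟨0, fun _ _ => rfl⟩
  smul_mem' := by
    rintro c f ⟨N, hN⟩
    exact ⟨N, fun n hn => by simp [hN n hn]⟩

namespace LaurentInf

/-- `g(x) ^ n = (a x + b) ^ n = ∑ i ≥ 0, (n choose i) a ^ (n - i) b ^ i x ^ (n - i)`, for `n : ℤ`,
as an element of `ℂ((x⁻¹))`. The coefficient of `x ^ m` is the term with `i = n - m`. -/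
def linPow (g : LinPoly) (n : ℤ) : LaurentInf :=
  ⟨fun m => if m ≤ n then
      ((Ring.choose n (n - m).toNat : ℤ) : ℂ) * (g.a : ℂ) ^ m * g.b ^ (n - m).toNat else 0,
    n, fun _ hm => if_neg (not_le.mpr hm)⟩

/-- The derivation `d/dx` of `ℂ((x⁻¹))`. -/
def deriv : LaurentInf →ₗ[ℂ] LaurentInf where
  toFun f := ⟨fun n => ((n : ℂ) + 1) * f.1 (n + 1), by
    obtain ⟨N, hN⟩ := f.2
    exact ⟨N, fun n hn => by simp [hN (n + 1) (by omega)]⟩⟩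
  map_add' f g := by ext n; simp [mul_add]
  map_smul' c f := by ext n; simp; ring

end LaurentInf

/-! ### The space `ℰᵒ(W) = Hom(W, W((x⁻¹)))` -/

/-- Formal series in two variables with coefficients in `End W`; the value at `m n` is the
coefficient of (first variable) `^ m` (second variable) `^ n`. -/
abbrev Series₂ (W : Type*) [AddCommGroup W] [Module ℂ W] := ℤ → ℤ → Module.End ℂ W

/-- `ℰᵒ(W) = Hom(W, W((x⁻¹)))` as a subspace of `(End W)[[x, x⁻¹]]`: for every `w` the powers of
`x` occurring in `a(x) w` are bounded above. -/
def FieldAtInf (W : Type*) [AddCommGroup W] [Module ℂ W] :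
    Submodule ℂ (ℤ → Module.End ℂ W) where
  carrier := {a | ∀ w : W, ∃ N : ℤ, ∀ n, N < n → a n w = 0}
  add_mem' := by
    intro a b ha hb w
    obtain ⟨N, hN⟩ := ha w
    obtain ⟨M, hM⟩ := hb w
    refine ⟨max N M, fun n hn => ?_⟩
    simp [hN n (lt_of_le_of_lt (le_max_left _ _) hn),
      hM n (lt_of_le_of_lt (le_max_right _ _) hn)]
  zero_mem' := fun _ => ⟨0, fun _ _ => rfl⟩
  smul_mem' := by
    intro c a ha w
    obtain ⟨N, hN⟩ := ha w
    exact ⟨N, fun n hn => by simp [hN n hn]⟩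

namespace FieldAtInf

variable {W : Type*} [AddCommGroup W] [Module ℂ W]

theorem finite_support_smul (f : LaurentInf) (a : FieldAtInf W) (n : ℤ) (w : W) :
    (Function.support fun k : ℤ => f.1 k • a.1 (n - k) w).Finite := by
  obtain ⟨N, hN⟩ := f.2
  obtain ⟨M, hM⟩ := a.2 w
  refine (Set.finite_Icc (n - M) N).subset fun k hk => ?_
  by_contra hc
  apply hk
  rw [Set.mem_Icc, not_and_or, not_le, not_le] at hc
  rcases hc with hc | hc
  · simp [hM (n - k) (by omega)]
  · simp [hN k hc]

/-- The action of `ℂ((x⁻¹))` on `ℰᵒ(W)`: the product `f(x) a(x)`. The sum is finite on every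
vector. -/
def lmul (f : LaurentInf) (a : FieldAtInf W) : FieldAtInf W :=
  ⟨fun n =>
    { toFun := fun w => ∑ᶠ k : ℤ, f.1 k • a.1 (n - k) w
      map_add' := fun w w' => by
        rw [← finsum_add_distrib (finite_support_smul f a n w) (finite_support_smul f a n w')]
        simp
      map_smul' := fun c w => by
        rw [RingHom.id_apply, smul_finsum' c (finite_support_smul f a n w)]
        simp [smul_comm c] },
    fun w => by
      obtain ⟨N, hN⟩ := f.2
      obtain ⟨M, hM⟩ := a.2 w
      refine ⟨N + M, fun n hn => ?_⟩
      change ∑ᶠ k : ℤ, f.1 k • a.1 (n - k) w = 0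
      rw [← finsum_zero (α := ℤ)]
      congr 1
      funext k
      rcases lt_or_ge N k with h | h
      · simp [hN k h]
      · simp [hM (n - k) (by omega)]⟩

theorem finite_support_subst (g : LinPoly) (a : FieldAtInf W) (n : ℤ) (w : W) :
    (Function.support fun k : ℤ => (LaurentInf.linPow g k).1 n • a.1 k w).Finite := by
  obtain ⟨M, hM⟩ := a.2 w
  refine (Set.finite_Icc n M).subset fun k hk => ?_
  by_contra hc
  apply hk
  rw [Set.mem_Icc, not_and_or, not_le, not_le] at hc
  rcases hc with hc | hc
  · simp [LaurentInf.linPow, not_le.mpr hc]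
  · simp [hM k hc]

/-- The substitution `a(g(x)) = ∑ k, a_k g(x) ^ k` for `a(x) = ∑ k, a_k x ^ k` in `ℰᵒ(W)`. The sum
giving the coefficient of `x ^ n` is finite on every vector. -/
def subst (g : LinPoly) (a : FieldAtInf W) : FieldAtInf W :=
  ⟨fun n =>
    { toFun := fun w => ∑ᶠ k : ℤ, (LaurentInf.linPow g k).1 n • a.1 k w
      map_add' := fun w w' => by
        rw [← finsum_add_distrib (finite_support_subst g a n w) (finite_support_subst g a n w')]
        simp
      map_smul' := fun c w => by
        rw [RingHom.id_apply, smul_finsum' c (finite_support_subst g a n w)]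
        simp [smul_comm c] },
    fun w => by
      obtain ⟨M, hM⟩ := a.2 w
      refine ⟨M, fun n hn => ?_⟩
      change ∑ᶠ k : ℤ, (LaurentInf.linPow g k).1 n • a.1 k w = 0
      rw [← finsum_zero (α := ℤ)]
      congr 1
      funext k
      rcases lt_or_ge M k with h | h
      · simp [hM k h]
      · simp [LaurentInf.linPow, not_le.mpr (lt_of_le_of_lt h hn)]⟩

/-- The product `a(x₁) b(x₂)`. -/
def prod₂ (a b : FieldAtInf W) : Series₂ W := fun m n => a.1 m * b.1 n

/-- The commutator `[a(x₁), b(x₂)] = a(x₁) b(x₂) - b(x₂) a(x₁)`. -/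
def comm₂ (a b : FieldAtInf W) : Series₂ W := fun m n => a.1 m * b.1 n - b.1 n * a.1 m

/-- The product of `a(x₂)` with
`(1 / j!) (∂/∂x₂) ^ j x₁⁻¹ δ(g(x₂) / x₁) = ∑ k, x₁ ^ (-k-1) (1 / j!) (d/dx₂) ^ j g(x₂) ^ k`. -/
def mulDelta (a : FieldAtInf W) (j : ℕ) (g : LinPoly) : Series₂ W := fun m =>
  (lmul ((j.factorial : ℂ)⁻¹ • (LaurentInf.deriv ^ j) (LaurentInf.linPow g (-m - 1))) a).1

end FieldAtInf

namespace Series₂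

variable {W : Type*} [AddCommGroup W] [Module ℂ W]

/-- Multiplication by a polynomial; `X 0` is the first and `X 1` the second variable. -/
def polyMul (p : MvPolynomial (Fin 2) ℂ) (A : Series₂ W) : Series₂ W := fun m n =>
  ∑ s ∈ p.support, p.coeff s • A (m - (s 0 : ℤ)) (n - (s 1 : ℤ))

/-- `A(x₁, x₂) ∈ Hom(W, W((x₁⁻¹, x₂⁻¹)))`: on every vector the powers of both variables are
bounded above. -/
def IsTruncated (A : Series₂ W) : Prop :=
  ∀ w : W, ∃ N : ℤ, ∀ m n : ℤ, N < m ∨ N < n → A m n w = 0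

/-- The coefficient of `x₀ ^ i x₂ ^ k` in `A(x₁, x₂) w` with `x₁ = x₂ + x₀`, where
`(x₂ + x₀) ^ m` is expanded in nonnegative powers of `x₀`. The sum is finite if `A` is truncated. -/
def substAdd (A : Series₂ W) (i k : ℤ) (w : W) : W :=
  if 0 ≤ i then ∑ᶠ m : ℤ, ((Ring.choose m i.toNat : ℤ) : ℂ) • A m (k + i - m) w else 0

end Series₂

/-- The polynomial `x₁ - g(x₂)`. -/
def LinPoly.factor (g : LinPoly) : MvPolynomial (Fin 2) ℂ :=
  MvPolynomial.X 0 - (MvPolynomial.C (g.a : ℂ) * MvPolynomial.X 1 + MvPolynomial.C g.b)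

/-- The polynomial `p(x₀ + x₂, x₂)`, in which the first variable is `x₀` and the second `x₂`. -/
def MvPolynomial.shiftFirst (p : MvPolynomial (Fin 2) ℂ) : MvPolynomial (Fin 2) ℂ :=
  MvPolynomial.aeval
    ![(MvPolynomial.X 0 + MvPolynomial.X 1 : MvPolynomial (Fin 2) ℂ), MvPolynomial.X 1] p

/-- A set `U` of fields is `Δ`-local, for a subgroup `Δ` of `G`: for all `a, b` in `U` a product of
polynomials `x₁ - g(x₂)` with `g ∈ Δ`, repetitions allowed, annihilates `[a(x₁), b(x₂)]`. -/
def FieldAtInf.IsLocal {W : Type*} [AddCommGroup W] [Module ℂ W] (Δ : Subgroup LinPoly)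
    (U : Set (FieldAtInf W)) : Prop :=
  ∀ a ∈ U, ∀ b ∈ U, ∃ s : Multiset LinPoly, (∀ g ∈ s, g ∈ Δ) ∧
    Series₂.polyMul (s.map LinPoly.factor).prod (FieldAtInf.comm₂ a b) = 0

/-! ### Vertex algebras, vertex `Γ`-algebras and their quasi modules at infinity -/

/-- A vertex algebra over `ℂ`. `VertexOperator.ncoeff (Y u) n v` is `u_n v`, where
`Y(u, x) = ∑ n, u_n x ^ (-n-1)` takes values in `Hom(V, V((x)))`. The last axiom is the Jacobi
identity in components (the coefficient of `x₀ ^ (-l-1) x₁ ^ (-m-1) x₂ ^ (-n-1)`); all its sums are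
finite, because `u_n v = 0` for `n` large. -/
structure VertexAlgebra (V : Type*) [AddCommGroup V] [Module ℂ V] where
  /-- The vertex operator map. -/
  Y : V →ₗ[ℂ] VertexOperator ℂ V
  /-- The vacuum vector. -/
  vac : V
  /-- `Y(𝟏, x) v = v`. -/
  vac_apply : ∀ (n : ℤ) (v : V),
    VertexOperator.ncoeff (Y vac) n v = if n = -1 then v else 0
  /-- `Y(v, x) 𝟏` has no negative powers of `x`. -/
  apply_vac : ∀ (v : V) (n : ℤ), 0 ≤ n → VertexOperator.ncoeff (Y v) n vac = 0
  /-- `Y(v, x) 𝟏` has constant term `v`. -/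
  creation : ∀ v : V, VertexOperator.ncoeff (Y v) (-1) vac = v
  jacobi : ∀ (u v w : V) (l m n : ℤ),
    ∑ᶠ i : ℕ, ((Ring.choose m i : ℤ) : ℂ) •
        VertexOperator.ncoeff (Y (VertexOperator.ncoeff (Y u) (l + i) v)) (m + n - i) w
      = ∑ᶠ i : ℕ, ((-1 : ℂ) ^ i * ((Ring.choose l i : ℤ) : ℂ)) •
          VertexOperator.ncoeff (Y u) (m + l - i) (VertexOperator.ncoeff (Y v) (n + i) w)
        - (-1 : ℂ) ^ l • ∑ᶠ i : ℕ, ((-1 : ℂ) ^ i * ((Ring.choose l i : ℤ) : ℂ)) •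
          VertexOperator.ncoeff (Y v) (n + l - i) (VertexOperator.ncoeff (Y u) (m + i) w)

/-- The product `u_n v` in a vertex algebra. -/
def VertexAlgebra.nprod {V : Type*} [AddCommGroup V] [Module ℂ V] (A : VertexAlgebra V)
    (u : V) (n : ℤ) (v : V) : V :=
  VertexOperator.ncoeff (A.Y u) n v

/-- A vertex `Γ`-algebra. -/
structure VertexGammaAlgebra (Γ : Type*) [Group Γ] (V : Type*) [AddCommGroup V] [Module ℂ V]
    extends VertexAlgebra V where
  L : Γ →* (V ≃ₗ[ℂ] V)
  φ : Γ →* ℂˣ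
  L_vac : ∀ g : Γ, L g vac = vac
  /-- `L(g) Y(u, x) v = Y(L(g) u, φ(g) x) L(g) v`, compared at `x ^ (-n-1)`. -/
  L_Y : ∀ (g : Γ) (u v : V) (n : ℤ),
    L g (toVertexAlgebra.nprod u n v)
      = (φ g : ℂ) ^ (-n - 1) • toVertexAlgebra.nprod (L g u) n (L g v)

/-- A quasi module at infinity for a vertex algebra. -/
structure QuasiModuleAtInf {V : Type*} [AddCommGroup V] [Module ℂ V] (A : VertexAlgebra V)
    (W : Type*) [AddCommGroup W] [Module ℂ W] where
  /-- The map `v ↦ Y_W(v, x)`; `(YW v).1 n` is the coefficient of `x ^ n`. -/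
  YW : V →ₗ[ℂ] FieldAtInf W
  /-- `Y_W(𝟏, x) = 1_W`. -/
  YW_vac : (YW A.vac).1 = Pi.single 0 1
  /-- For some nonzero polynomial `p`, the series `p(x₁, x₂) Y_W(u, x₁) Y_W(v, x₂)` lies in
  `Hom(W, W((x₁⁻¹, x₂⁻¹)))` and becomes `p(x₀ + x₂, x₂) Y_W(Y(u, x₀) v, x₂)` at `x₁ = x₂ + x₀`. -/
  weak_assoc : ∀ u v : V, ∃ p : MvPolynomial (Fin 2) ℂ, p ≠ 0 ∧
    (Series₂.polyMul p (FieldAtInf.prod₂ (YW u) (YW v))).IsTruncated ∧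
    ∀ (i k : ℤ) (w : W),
      (Series₂.polyMul p (FieldAtInf.prod₂ (YW u) (YW v))).substAdd i k w
        = Series₂.polyMul p.shiftFirst
            (fun i' k' => (YW (A.nprod u (-i' - 1) v)).1 k') i k w

/-- A quasi module at infinity for a vertex `Γ`-algebra. -/
structure GammaQuasiModuleAtInf {Γ : Type*} [Group Γ] {V : Type*} [AddCommGroup V] [Module ℂ V]
    (A : VertexGammaAlgebra Γ V) (W : Type*) [AddCommGroup W] [Module ℂ W]
    extends QuasiModuleAtInf A.toVertexAlgebra W where
  Ψ : Γ →* LinPoly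
  φ_eq : A.φ = LinPoly.leading.comp Ψ
  /-- `Y_W(L(g) v, x) = Y_W(v, Ψ(g)⁻¹(x))`. -/
  covariance : ∀ (g : Γ) (v : V), YW (A.L g v) = FieldAtInf.subst (Ψ g)⁻¹ (YW v)
  isLocal : FieldAtInf.IsLocal Ψ.range (Set.range YW)

namespace GammaQuasiModuleAtInf

variable {Γ : Type*} [Group Γ] {V : Type*} [AddCommGroup V] [Module ℂ V]
  {A : VertexGammaAlgebra Γ V} {W : Type*} [AddCommGroup W] [Module ℂ W]

/-- The series
`φ(σ)⁻¹ Y_W((L(σ) u)_j v, x₂) (1 / j!) (∂/∂x₂) ^ j x₁⁻¹ δ(Ψ(σ)⁻¹(x₂) / x₁)`. -/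
def commTerm (M : GammaQuasiModuleAtInf A W) (u v : V) (σ : Γ) (j : ℕ) : Series₂ W :=
  ((A.φ σ)⁻¹ : ℂ) • FieldAtInf.mulDelta (M.YW (A.nprod (A.L σ u) j v)) j (M.Ψ σ)⁻¹

/-- For fixed `σ` only finitely many `j` contribute. -/
theorem finite_support_commTerm (M : GammaQuasiModuleAtInf A W) (u v : V) (σ : Γ) :
    (Function.support (M.commTerm u v σ)).Finite := by
  set o := HahnSeries.order ((HahnModule.of ℂ).symm (A.Y (A.L σ u) v)) with ho
  refine (Set.finite_Iic (-o).toNat).subset fun j hj => ?_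
  by_contra hc
  apply hj
  have h0 : A.nprod (A.L σ u) j v = 0 := by
    apply VertexOperator.ncoeff_eq_zero_of_lt_order
    rw [← ho]
    simp only [Set.mem_Iic, not_le] at hc
    omega
  funext m n
  ext w
  simp [commTerm, h0, FieldAtInf.mulDelta, FieldAtInf.lmul]

end GammaQuasiModuleAtInf

end

noncomputable section

/-! Fix `w` in `W` and read a series in `x₁`, `x₂` as a sequence indexed by the power of `x₁`, with
entries in `W((x₂⁻¹))`, a vector space over the field `ℂ((x₂⁻¹))`. Multiplication by `x₁` is the
shift, and `x₁ - g(x₂)` is a monic linear polynomial in it, so the problem concerns sequences killed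
by a product of linear factors over a field.

Let `A = Y_W(u, x₁) Y_W(v, x₂) w` and `B = Y_W(v, x₂) Y_W(u, x₁) w`. A locality polynomial `q` gives
`q A = q B = F`. Powers of `x₂` are bounded above in `A` and powers of `x₁` in `B`, so `F` is
bounded in both variables. Thus `A` and `B` are two expansions of `F / q`, and `A - B` is a
combination of delta functions at the poles `x₁ = g(x₂)`, weighted by the polar parts. The sign
comes from `1 / (x₁ - g)`: it is `-∑ x₁ ^ k g ^ (-k-1)` in the region of `A` and `∑ x₁ ^ (-k-1) g ^
k` in that of `B` (`k ≥ 0`), with difference `-x₁⁻¹ δ(g / x₁)`.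

The polar part at `g = Ψ(σ)⁻¹` is found by putting `x₁ = g(x₂ + x₀)`. Covariance turns `Y_W(u, x₁)`
into `Y_W(L(σ)u, x₂ + x₀)`, and weak associativity makes `Y_W(Y(L(σ)u, x₀)v, x₂) w` the Laurent
expansion (`op_iterVec`). The local parameter is `x₁ - g(x₂) = a x₀` with `a = φ(σ)⁻¹`; so order `j`
carries `a ^ (j + 1)`, of which `a ^ j` is absorbed by `(∂/∂x₂) ^ j` through the chain rule and
`φ(σ)⁻¹` remains.

A single pole is treated by comparing residues (`cf_residue_sub`, `sub_add_deltaSum_eq_zero`);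
several poles are separated by a Bézout relation (`eq_zero_of_coprime`). Where `q` has no root there
is no polar part (`commTerm_eq_zero`), which allows the sum over all of `Γ` when `Ψ` is injective.
-/

open Polynomial in
/-- A linear map intertwining `T` and `T'` on a `T`-stable subspace intertwines polynomials in
them. -/
theorem Module.End.aeval_intertwine {K M N : Type*} [CommRing K] [AddCommGroup M] [Module K M]
    [AddCommGroup N] [Module K N] (f : M →ₗ[K] N) (T : Module.End K M) (T' : Module.End K N)
    (P : Submodule K M) (hT : ∀ x ∈ P, T x ∈ P) (h : ∀ x ∈ P, f (T x) = T' (f x)) (p : K[X]) :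
    ∀ x ∈ P, aeval T p x ∈ P ∧ f (aeval T p x) = aeval T' p (f x) := by
  induction p using Polynomial.induction_on with
  | C a =>
    intro x hx
    simp only [aeval_C, Module.algebraMap_end_apply]
    exact ⟨P.smul_mem a hx, map_smul f a x⟩
  | add p q hp hq =>
    intro x hx
    simp only [map_add, LinearMap.add_apply]
    exact ⟨P.add_mem (hp x hx).1 (hq x hx).1, by rw [(hp x hx).2, (hq x hx).2]⟩
  | monomial n a ih =>
    intro x hx
    have e : (C a * X ^ (n + 1) : K[X]) = (C a * X ^ n) * X := by ring
    rw [e]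
    simp only [map_mul (aeval T), map_mul (aeval T'), Module.End.mul_apply, aeval_X]
    rw [← h x hx]
    have := ih (T x) (hT x hx)
    simpa only [map_mul, Module.End.mul_apply] using this

/-- Pascal's rule in `ℤ`, cast to a field. -/
theorem Ring.cast_choose_succ_succ {K : Type*} [Field K] (m : ℤ) (j : ℕ) :
    ((Ring.choose (m + 1) (j + 1) : ℤ) : K)
      = ((Ring.choose m j : ℤ) : K) + ((Ring.choose m (j + 1) : ℤ) : K) := by
  rw [Ring.choose_succ_succ]; push_cast; rfl

/-! ### Sequences and the shift operator -/

namespace ShiftSeq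

open Polynomial

variable {K H : Type*} [Field K] [AddCommGroup H] [Module K H]

variable (K H) in
/-- The shift operator: multiplication of `∑ c_m x ^ m` by `x`. -/
def shift : Module.End K (ℤ → H) where
  toFun c m := c (m - 1)
  map_add' _ _ := rfl
  map_smul' _ _ := rfl

@[simp] theorem shift_apply (c : ℤ → H) (m : ℤ) : shift K H c m = c (m - 1) := rfl

theorem shift_pow_apply (k : ℕ) (c : ℤ → H) (m : ℤ) : (shift K H ^ k) c m = c (m - k) := by
  induction k generalizing m with
  | zero => simp
  | succ k ih =>
    rw [pow_succ', Module.End.mul_apply, shift_apply, ih]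
    congr 1; push_cast; ring

/-- The operator `shift - g`. -/
def shiftSub (g : K) : Module.End K (ℤ → H) := aeval (shift K H) (X - C g)

theorem shiftSub_apply (g : K) (c : ℤ → H) (m : ℤ) :
    shiftSub g c m = c (m - 1) - g • c m := by
  simp [shiftSub]

theorem shiftSub_pow (g : K) (k : ℕ) :
    (shiftSub g : Module.End K (ℤ → H)) ^ k = aeval (shift K H) ((X - C g) ^ k) := by
  simp [shiftSub]

/-! ### Delta functions at `g` and the local coordinate `x₀ = x - g` -/

/-- The coefficients of `h (1 / j!) (∂ / ∂g) ^ j x⁻¹ δ(g / x)`. -/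
def deltaTerm (g : K) (j : ℕ) : H →ₗ[K] (ℤ → H) where
  toFun h m := (((Ring.choose (-m - 1) j : ℤ) : K) * g ^ (-m - 1 - j)) • h
  map_add' h h' := by ext; simp
  map_smul' c h := by ext; simp [smul_comm c]

theorem deltaTerm_apply (g : K) (j : ℕ) (h : H) (m : ℤ) :
    deltaTerm g j h m = (((Ring.choose (-m - 1) j : ℤ) : K) * g ^ (-m - 1 - j)) • h := rfl

/-- The combination of delta functions at `g` whose coefficients are the coefficients of negative
powers in the sequence `Y`. -/
def deltaSum (g : K) (J : ℕ) : (ℤ → H) →ₗ[K] (ℤ → H) :=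
  ∑ j ∈ Finset.range J, deltaTerm g j ∘ₗ LinearMap.proj (-(j : ℤ) - 1)

theorem deltaSum_apply (g : K) (J : ℕ) (Y : ℤ → H) :
    deltaSum g J Y = ∑ j ∈ Finset.range J, deltaTerm g j (Y (-(j : ℤ) - 1)) := by
  simp [deltaSum]

theorem deltaSum_eq_zero (g : K) (J : ℕ) {Y : ℤ → H} (hY : ∀ i < 0, Y i = 0) :
    deltaSum g J Y = 0 := by
  rw [deltaSum_apply]
  refine Finset.sum_eq_zero fun j _ => ?_
  rw [hY _ (by omega), map_zero]

/-- At `m = -1` the binomial coefficient is `choose 0 j`, so only order zero survives: the residue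
is the coefficient of `x₀⁻¹`. The bound on `Y` matters only for `J = 0`, where the sum is empty. -/
theorem deltaSum_neg_one (g : K) (J : ℕ) {Y : ℤ → H} (hY : ∀ i < -(J : ℤ), Y i = 0) :
    deltaSum g J Y (-1) = Y (-1) := by
  rw [deltaSum_apply, Finset.sum_apply]
  cases J with
  | zero => simp [hY (-1) (by simp)]
  | succ J =>
    rw [Finset.sum_range_succ', Finset.sum_eq_zero]
    · simp [deltaTerm_apply]
    · intro j _
      simp [deltaTerm_apply, Ring.choose_zero_succ]

variable (K H) in
/-- The sequences vanishing below `-J`. -/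
def vanishBelow (J : ℕ) : Submodule K (ℤ → H) where
  carrier := {Y | ∀ i < -(J : ℤ), Y i = 0}
  add_mem' ha hb i hi := by simp [ha i hi, hb i hi]
  zero_mem' _ _ := rfl
  smul_mem' c a ha i hi := by simp [ha i hi]

/-- `shift + g`: multiplication by `x + g`. -/
def shiftAdd (g : K) : Module.End K (ℤ → H) := shift K H + algebraMap K _ g

theorem shiftAdd_apply (g : K) (c : ℤ → H) (m : ℤ) :
    shiftAdd g c m = c (m - 1) + g • c m := by
  simp [shiftAdd]

theorem shiftAdd_mem {J : ℕ} (g : K) {Y : ℤ → H} (hY : Y ∈ vanishBelow K H J) :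
    shiftAdd g Y ∈ vanishBelow K H J := by
  intro i hi
  rw [shiftAdd_apply, hY i hi, hY (i - 1) (by omega)]; simp

/-- Multiplication by `x` is multiplication by `x₀ + g` on Laurent coefficients. On delta functions
this is `x δ_(j+1) = δ_j + g δ_(j+1)`, which is Pascal's rule. Vanishing below `-J` removes the one
coefficient that would leave the range of summation. -/
theorem deltaSum_shiftAdd {g : K} (hg : g ≠ 0) (J : ℕ) {Y : ℤ → H}
    (hY : Y ∈ vanishBelow K H J) :
    deltaSum g J (shiftAdd g Y) = shift K H (deltaSum g J Y) := by
  rw [deltaSum_apply, deltaSum_apply]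
  cases J with
  | zero => simp
  | succ J =>
    funext m
    simp only [shift_apply, Finset.sum_apply]
    have hlast : Y (-(J : ℤ) - 1 - 1) = 0 := hY _ (by push_cast; omega)
    rw [Finset.sum_range_succ' (fun c => deltaTerm g c (Y (-(c : ℤ) - 1)) (m - 1))]
    have e1 : ∀ j : ℕ, deltaTerm g j (shiftAdd g Y (-(j : ℤ) - 1)) m
        = deltaTerm g j (Y (-(j : ℤ) - 1 - 1)) m + deltaTerm g j (g • Y (-(j : ℤ) - 1)) m := by
      intro j; rw [shiftAdd_apply, map_add, Pi.add_apply]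
    simp only [e1]
    rw [Finset.sum_add_distrib, Finset.sum_range_succ, hlast, map_zero, Pi.zero_apply, add_zero,
      Finset.sum_range_succ', ← add_assoc, ← Finset.sum_add_distrib]
    congr 1
    · refine Finset.sum_congr rfl fun j _ => ?_
      have e2 : (-((j + 1 : ℕ) : ℤ) - 1) = -(j : ℤ) - 1 - 1 := by push_cast; ring
      rw [e2]
      simp only [deltaTerm_apply, smul_smul, ← add_smul]
      congr 1
      have e3 : -(m - 1) - 1 = (-m - 1) + 1 := by ring
      rw [e3, Ring.cast_choose_succ_succ]
      have e4 : -m - 1 + 1 - ((j + 1 : ℕ) : ℤ) = -m - 1 - j := by push_cast; ring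
      have e5 : -m - 1 - (j : ℤ) = (-m - 1 - ((j + 1 : ℕ) : ℤ)) + 1 := by push_cast; ring
      rw [e4, mul_assoc, ← zpow_add_one₀ hg, ← e5]
      ring
    · simp only [deltaTerm_apply, smul_smul, Ring.choose_zero_right, Nat.cast_zero]
      congr 1
      have e6 : -(m - 1) - 1 - 0 = (-m - 1 - 0) + 1 := by ring
      rw [e6, zpow_add_one₀ hg]
      ring

theorem deltaSum_aeval {g : K} (hg : g ≠ 0) (J : ℕ) (p : K[X]) {Y : ℤ → H}
    (hY : Y ∈ vanishBelow K H J) :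
    aeval (shiftAdd g) p Y ∈ vanishBelow K H J ∧
      deltaSum g J (aeval (shiftAdd g) p Y) = aeval (shift K H) p (deltaSum g J Y) :=
  Module.End.aeval_intertwine (deltaSum g J) (shiftAdd g) (shift K H) (vanishBelow K H J)
    (fun _ => shiftAdd_mem g) (fun _ => deltaSum_shiftAdd hg J) p Y hY

/-- In the coordinate `x₀` the factor `x - g` is `x₀` itself, so a pole at `g` is cleared by moving
the Laurent expansion. -/
theorem aeval_shiftAdd_X_sub_C_pow (g : K) (k : ℕ) :
    aeval (shiftAdd g : Module.End K (ℤ → H)) ((X - C g) ^ k) = shift K H ^ k := by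
  simp [shiftAdd]

/-- Delta functions at `g` of order less than `J` are annihilated by `(x - g) ^ N`, `J ≤ N`. -/
theorem shiftSub_pow_deltaSum {g : K} (hg : g ≠ 0) {J N : ℕ} (hN : J ≤ N) {Y : ℤ → H}
    (hY : Y ∈ vanishBelow K H J) :
    aeval (shift K H) ((X - C g) ^ N) (deltaSum g J Y) = 0 := by
  rw [← (deltaSum_aeval hg J _ hY).2, aeval_shiftAdd_X_sub_C_pow]
  refine deltaSum_eq_zero g J fun i hi => ?_
  rw [shift_pow_apply]
  exact hY _ (by omega)

/-! ### Uniqueness for sequences annihilated by polynomials -/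

/-- A sequence annihilated by a power of `x - g` vanishes when all its moments do. -/
theorem eq_zero_of_moments {g : K} (hg : g ≠ 0) (k : ℕ) {D : ℤ → H}
    (hk : aeval (shift K H) ((X - C g) ^ k) D = 0)
    (hm : ∀ j < k, aeval (shift K H) ((X - C g) ^ j) D (-1) = 0) : D = 0 := by
  induction k generalizing D with
  | zero => simpa using hk
  | succ k ih =>
    -- By induction `(x - g) D` vanishes, so `D` is geometric; since `g ≠ 0`, the single value `D
    -- (-1) = 0` propagates in both directions.
    have h1 : shiftSub g D = 0 := by
      apply ih
      · rw [shiftSub, ← Module.End.mul_apply, ← map_mul, ← pow_succ]; exact hk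
      · intro j hj
        rw [shiftSub, ← Module.End.mul_apply, ← map_mul, ← pow_succ]
        exact hm _ (by omega)
    have h0 : D (-1) = 0 := by simpa using hm 0 (by omega)
    have hrec : ∀ m, D (m - 1) = g • D m := fun m => by
      have := congrFun h1 m
      rw [shiftSub_apply] at this
      exact sub_eq_zero.mp this
    have hiff : ∀ m, D (m - 1) = 0 ↔ D m = 0 := fun m => by
      rw [hrec m, smul_eq_zero]; simp [hg]
    funext m
    induction m using Int.induction_on with
    | zero => have := (hiff 0).1 (by simpa using h0); simpa using this
    | succ n hn => exact (hiff _).1 (by simpa using hn)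
    | pred n hn => exact (hiff _).2 hn

/-- A sequence annihilated by the products `∏ l ∈ t \ {i}, (x - ρ l) ^ N` for all `i` in `t` is
zero. -/
theorem eq_zero_of_coprime {ι : Type*} [DecidableEq ι] {t : Finset ι} (ht : t.Nonempty)
    {ρ : ι → K} (hρ : Function.Injective ρ) (N : ℕ) {D : ℤ → H}
    (h : ∀ i ∈ t, aeval (shift K H) (∏ l ∈ t \ {i}, (X - C (ρ l)) ^ N) D = 0) : D = 0 := by
  have hco : Pairwise (Function.onFun IsCoprime
      fun i : t => (fun l => (X - C (ρ l)) ^ N) (i : ι)) := by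
    intro i j hij
    have h1 : IsCoprime (X - C (ρ i)) (X - C (ρ j)) :=
      pairwise_coprime_X_sub_C hρ (fun e => hij (Subtype.ext e))
    exact h1.pow
  -- Bézout: the products omitting one root each generate the unit ideal.
  obtain ⟨μ, hμ⟩ : ∃ μ : ι → K[X], ∑ i ∈ t, μ i * ∏ j ∈ t \ {i}, (X - C (ρ j)) ^ N = 1 :=
    (exists_sum_eq_one_iff_pairwise_coprime ht).2 hco
  have h1 : aeval (shift K H) (1 : K[X]) D = 0 := by
    rw [← hμ, map_sum, LinearMap.sum_apply]
    refine Finset.sum_eq_zero fun i hi => ?_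
    rw [map_mul, Module.End.mul_apply, h i hi, map_zero]
  simpa using h1

/-- If `(x + c) Y` has no negative powers, `c ≠ 0`, and `Y` is bounded below, then `Y` has no
negative powers. -/
theorem neg_part_eq_zero {c : K} (hc : c ≠ 0) {J : ℕ} {Y : ℤ → H} (hY : Y ∈ vanishBelow K H J)
    (h : ∀ i < 0, Y (i - 1) + c • Y i = 0) : ∀ i < 0, Y i = 0 := by
  -- Induction upwards from `-J`: once the entry at `i - 1` is zero, `c ≠ 0` kills the entry at `i`.
  have key : ∀ n : ℕ, ∀ i : ℤ, i < 0 → i < -(J : ℤ) + n → Y i = 0 := by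
    intro n
    induction n with
    | zero => intro i _ hi; exact hY i (by simpa using hi)
    | succ n ih =>
      intro i hi hi'
      have := h i hi
      rw [ih (i - 1) (by omega) (by push_cast at hi'; omega), zero_add, smul_eq_zero] at this
      exact this.resolve_left hc
  intro i hi
  exact key J i hi (by omega)

/-- If `p (x + g) Y` has no negative powers, where `p` is a product of factors `x - h` with
`h ≠ g`, then `Y` has no negative powers. -/
theorem neg_part_eq_zero_of_prod {g : K} {J : ℕ} (s : Multiset K) (hs : ∀ h ∈ s, h ≠ g)
    {Y : ℤ → H} (hY : Y ∈ vanishBelow K H J)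
    (h : ∀ i < 0, aeval (shiftAdd g) (s.map fun h => X - C h).prod Y i = 0) :
    ∀ i < 0, Y i = 0 := by
  induction s using Multiset.induction_on generalizing Y with
  | empty => simpa using h
  | cons a s ih =>
    have hm : aeval (shiftAdd g : Module.End K (ℤ → H)) (X - C a) Y ∈ vanishBelow K H J := by
      intro i hi
      simp [shiftAdd_apply, hY i hi, hY (i - 1) (by omega)]
    have h1 := ih (fun b hb => hs b (Multiset.mem_cons_of_mem hb)) hm (fun i hi => by
      rw [← Module.End.mul_apply, ← map_mul, mul_comm, ← Multiset.prod_cons,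
        ← Multiset.map_cons (fun h => X - C h)]
      exact h i hi)
    -- In the coordinate `x₀` the factor `x - a` is `x₀ + (g - a)`, with nonzero constant term.
    refine neg_part_eq_zero (c := g - a)
      (sub_ne_zero.2 (hs a (Multiset.mem_cons_self a s)).symm) hY fun i hi => ?_
    have := h1 i hi
    simp only [map_sub, aeval_X, aeval_C, LinearMap.sub_apply, Module.algebraMap_end_apply,
      Pi.sub_apply, shiftAdd_apply, Pi.smul_apply] at this
    rw [← this, sub_smul]; abel

end ShiftSeq

/-! ### Binomial identities -/

theorem Ring.succ_mul_choose_succ (r : ℤ) (i : ℕ) :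
    ((i : ℤ) + 1) * Ring.choose r (i + 1) = (r - i) * Ring.choose r i := by
  have h := Ring.choose_smul_choose r (n := i + 1) (k := i) (Nat.le_succ i)
  rw [Nat.choose_succ_self_right, Nat.add_sub_cancel_left, Ring.choose_one_right, nsmul_eq_mul] at h
  push_cast at h
  rw [h, mul_comm]

theorem Ring.succ_mul_choose_succ' (r : ℤ) (i : ℕ) :
    ((i : ℤ) + 1) * Ring.choose r (i + 1) = r * Ring.choose (r - 1) i := by
  have h := Ring.choose_smul_choose r (n := i + 1) (k := 1) (Nat.succ_le_succ (Nat.zero_le i))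
  rw [Nat.choose_one_right, Nat.add_sub_cancel, Ring.choose_one_right, nsmul_eq_mul] at h
  push_cast at h
  exact h

/-! ### The field `ℂ((x⁻¹))` and the module `W((x⁻¹))` -/

namespace InfSeries

section

variable {W : Type*} [AddCommGroup W]

/-- The powers of `x` occurring in `∑ f n x ^ n` are bounded above. -/
def BddSupp (f : ℤ → W) : Prop := ∃ N : ℤ, ∀ n, N < n → f n = 0

theorem BddSupp.add {f g : ℤ → W} (hf : BddSupp f) (hg : BddSupp g) : BddSupp (f + g) := by
  obtain ⟨N, hN⟩ := hf
  obtain ⟨M, hM⟩ := hg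
  exact ⟨max N M, fun n hn => by simp [hN n (by omega), hM n (by omega)]⟩

theorem BddSupp.shift {f : ℤ → W} (k : ℤ) (hf : BddSupp f) : BddSupp (fun n => f (n - k)) := by
  obtain ⟨N, hN⟩ := hf
  exact ⟨N + k, fun n hn => hN _ (by omega)⟩

end

variable {W : Type*} [AddCommGroup W] [Module ℂ W]

theorem BddSupp.smul {f : ℤ → W} (c : ℂ) (hf : BddSupp f) : BddSupp (c • f) := by
  obtain ⟨N, hN⟩ := hf
  exact ⟨N, fun n hn => by simp [hN n hn]⟩

/-- The field `ℂ((x⁻¹))`, as Laurent series in the variable `x⁻¹`. -/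
def LaurentField : Type := HahnSeries ℤ ℂ

instance : Field LaurentField := inferInstanceAs (Field (HahnSeries ℤ ℂ))

/-- The coefficient of `x ^ n` in an element of `ℂ((x⁻¹))`. -/
def LaurentField.cf (n : ℤ) (f : LaurentField) : ℂ := HahnSeries.coeff (R := ℂ) f (-n)

theorem LaurentField.ext_cf {f g : LaurentField}
    (h : ∀ n, LaurentField.cf n f = LaurentField.cf n g) : f = g := by
  apply HahnSeries.ext
  funext n
  have := h (-n)
  simpa [LaurentField.cf] using this

variable (W) in
/-- The vector space `W((x⁻¹))` over `ℂ((x⁻¹))`. -/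
def InfModule : Type _ := HahnModule ℤ ℂ W

instance : AddCommGroup (InfModule W) := inferInstanceAs (AddCommGroup (HahnModule ℤ ℂ W))

instance : Module LaurentField (InfModule W) :=
  inferInstanceAs (Module (HahnSeries ℤ ℂ) (HahnModule ℤ ℂ W))

open Classical in
/-- The element `∑ f n x ^ n` of `W((x⁻¹))`. -/
def ofFun (f : ℤ → W) : InfModule W :=
  HahnModule.of ℂ <|
    if h : BddSupp f then
      HahnSeries.ofSuppBddBelow (fun n => f (-n)) (by
        obtain ⟨N, hN⟩ := h
        refine ⟨-N, fun n hn => ?_⟩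
        by_contra hc
        exact hn (hN _ (by omega)))
    else 0

/-- The coefficient of `x ^ n` in an element of `W((x⁻¹))`. -/
def cf (n : ℤ) : InfModule W →+ W where
  toFun h := HahnSeries.coeff ((HahnModule.of (V := W) ℂ).symm h) (-n)
  map_zero' := rfl
  map_add' _ _ := rfl

theorem cf_ofFun {f : ℤ → W} (hf : BddSupp f) (n : ℤ) : cf n (ofFun f) = f n := by
  change ((HahnModule.of ℂ).symm (ofFun f)).coeff (-n) = f n
  simp [ofFun, hf]

theorem ext_cf {h h' : InfModule W} (e : ∀ n, cf n h = cf n h') : h = h' := by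
  apply HahnModule.ext
  funext n
  have := e (-n)
  simpa [cf] using this

theorem bddSupp_cf (h : InfModule W) : BddSupp fun n => cf n h := by
  refine ⟨-((HahnModule.of (V := W) ℂ).symm h).order, fun n hn => ?_⟩
  exact HahnSeries.coeff_eq_zero_of_lt_order (by omega)

theorem _root_.HahnModule.coeff_smul_eq_finsum (f : HahnSeries ℤ ℂ) (h : HahnModule ℤ ℂ W)
    (n : ℤ) : ((HahnModule.of ℂ).symm (f • h)).coeff (-n)
      = ∑ᶠ k : ℤ, f.coeff (-k) • ((HahnModule.of ℂ).symm h).coeff (-(n - k)) := by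
  rw [HahnModule.coeff_smul]
  generalize_proofs hfin
  have hinj : Set.InjOn (fun ij : ℤ × ℤ => -ij.1) (Finset.VAddAntidiagonal (-n) hfin) := by
    intro x hx y hy hxy
    simp only [Finset.mem_coe, Finset.mem_vaddAntidiagonal, vadd_eq_add] at hx hy
    have h1 := hx.2.2
    have h2 := hy.2.2
    simp only [neg_inj] at hxy
    ext <;> omega
  rw [finsum_eq_sum_of_support_subset
    (s := (Finset.VAddAntidiagonal (-n) hfin).image fun ij : ℤ × ℤ => -ij.1),
    Finset.sum_image hinj]
  · refine Finset.sum_congr rfl fun x hx => ?_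
    simp only [Finset.mem_vaddAntidiagonal, vadd_eq_add] at hx
    have e : x.2 = -(n - -x.1) := by have := hx.2.2; omega
    change _ = f.coeff (- -x.1) •
      ((HahnModule.of ℂ).symm h).coeff (-(n - -x.1))
    rw [← e, neg_neg]
  · intro k hk
    simp only [Finset.coe_image, Set.mem_image, Finset.mem_coe, Finset.mem_vaddAntidiagonal,
      vadd_eq_add]
    refine ⟨(-k, -n + k), ⟨?_, ?_, by ring⟩, by simp⟩
    · intro h0
      apply hk
      change f.coeff (-k) • _ = _
      rw [h0, zero_smul]
    · intro h0
      apply hk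
      have e : -(n - k) = -n + k := by ring
      change _ • ((HahnModule.of ℂ).symm h).coeff (-(n - k)) = _
      rw [e, h0, smul_zero]

theorem cf_smul (f : LaurentField) (h : InfModule W) (n : ℤ) :
    cf n (f • h) = ∑ᶠ k : ℤ, LaurentField.cf k f • cf (n - k) h :=
  HahnModule.coeff_smul_eq_finsum (f : HahnSeries ℤ ℂ) (h : HahnModule ℤ ℂ W) n

/-- The constants in `ℂ((x⁻¹))`. -/
def const : ℂ →+* LaurentField := (HahnSeries.C : ℂ →+* HahnSeries ℤ ℂ)

theorem cf_const_mul (c : ℂ) (f : LaurentField) (n : ℤ) :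
    LaurentField.cf n (const c * f) = c * LaurentField.cf n f :=
  HahnSeries.coeff_single_zero_mul (R := ℂ)

theorem cf_const_smul (c : ℂ) (h : InfModule W) (n : ℤ) :
    cf n (const c • h) = c • cf n h :=
  HahnModule.coeff_single_zero_smul (V := W)

/-- The element `x` of `ℂ((x⁻¹))`. -/
def var : LaurentField := HahnSeries.single (-1 : ℤ) (1 : ℂ)

theorem cf_var_mul (f : LaurentField) (n : ℤ) :
    LaurentField.cf n (var * f) = LaurentField.cf (n - 1) f := by
  have h : ∀ f : HahnSeries ℤ ℂ,
      (HahnSeries.single (-1 : ℤ) (1 : ℂ) * f).coeff (-n) = f.coeff (-(n - 1)) := fun f => by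
    rw [HahnSeries.coeff_single_mul, one_mul]
    congr 1; ring
  exact h f

theorem cf_one (n : ℤ) : LaurentField.cf n 1 = if n = 0 then 1 else 0 := by
  change HahnSeries.coeff (1 : HahnSeries ℤ ℂ) (-n) = _
  rw [HahnSeries.coeff_one]; simp

theorem cf_var (n : ℤ) : LaurentField.cf n var = if n = 1 then 1 else 0 := by
  rw [← mul_one var, cf_var_mul, cf_one]
  congr 1; simp [sub_eq_zero]

theorem cf_var_smul (h : InfModule W) (n : ℤ) : cf n (var • h) = cf (n - 1) h := by
  rw [cf_smul, finsum_eq_single _ 1 (fun k hk => by simp [cf_var, hk])]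
  simp [cf_var]

/-- The polynomial `g(x) = a x + b` as an element of the field `ℂ((x⁻¹))`. -/
def lin (g : LinPoly) : LaurentField := const g.a * var + const g.b

theorem LaurentField.cf_add (f g : LaurentField) (n : ℤ) :
    LaurentField.cf n (f + g) = LaurentField.cf n f + LaurentField.cf n g := rfl

theorem lin_coeff (g : LinPoly) (n : ℤ) :
    (lin g).cf n = (if n = 1 then (g.a : ℂ) else 0) + if n = 0 then g.b else 0 := by
  rw [lin, LaurentField.cf_add, cf_const_mul, cf_var, ← mul_one (const g.b), cf_const_mul, cf_one]
  simp

theorem lin_ne_zero (g : LinPoly) : lin g ≠ 0 := by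
  intro h
  have h1 := congrArg (LaurentField.cf 1) h
  rw [lin_coeff] at h1
  have h2 : LaurentField.cf 1 0 = 0 := rfl
  simp [h2] at h1

theorem lin_injective : Function.Injective lin := by
  intro g h e
  have h0 := congrArg (LaurentField.cf 0) e
  have h1 := congrArg (LaurentField.cf 1) e
  simp only [lin_coeff] at h0 h1
  exact LinPoly.ext (Units.ext (by simpa using h1)) (by simpa using h0)

theorem cf_lin_smul (g : LinPoly) (h : InfModule W) (n : ℤ) :
    cf n (lin g • h) = (g.a : ℂ) • cf (n - 1) h + g.b • cf n h := by
  rw [lin, add_smul, mul_smul, map_add, cf_const_smul, cf_const_smul, cf_var_smul]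

/-- An element of `ℂ((x⁻¹))` as an element of the field of Laurent series in `x⁻¹`. -/
def toField (f : LaurentInf) : LaurentField :=
  HahnSeries.ofSuppBddBelow (fun n => f.1 (-n)) (by
    obtain ⟨N, hN⟩ := f.2
    refine ⟨-N, fun n hn => ?_⟩
    by_contra hc
    exact hn (hN _ (by omega)))

theorem cf_toField (f : LaurentInf) (n : ℤ) : (toField f).cf n = f.1 n :=
  congrArg f.1 (neg_neg n)

theorem toField_smul (c : ℂ) (f : LaurentInf) : toField (c • f) = const c * toField f :=
  LaurentField.ext_cf fun n => by rw [cf_const_mul, cf_toField, cf_toField]; rfl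

theorem linPow_apply (g : LinPoly) (n m : ℤ) : (LaurentInf.linPow g n).1 m = if m ≤ n then
    ((Ring.choose n (n - m).toNat : ℤ) : ℂ) * (g.a : ℂ) ^ m * g.b ^ (n - m).toNat else 0 := rfl

theorem linPow_succ (g : LinPoly) (n m : ℤ) : (LaurentInf.linPow g (n + 1)).1 m
    = (g.a : ℂ) * (LaurentInf.linPow g n).1 (m - 1) + g.b * (LaurentInf.linPow g n).1 m := by
  simp only [linPow_apply]
  have ha : (g.a : ℂ) ≠ 0 := g.a.ne_zero
  rcases lt_trichotomy m (n + 1) with h | h | h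
  · obtain ⟨i, rfl⟩ : ∃ i : ℕ, n = m + i := ⟨(n - m).toNat, by omega⟩
    rw [if_pos (by omega), if_pos (by omega), if_pos (by omega)]
    have e1 : (m + i + 1 - m).toNat = i + 1 := by omega
    have e2 : (m + i - (m - 1)).toNat = i + 1 := by omega
    have e3 : (m + i - m).toNat = i := by omega
    rw [e1, e2, e3, Ring.cast_choose_succ_succ, zpow_sub_one₀ ha]
    field_simp
    ring
  · subst h
    rw [if_pos le_rfl, if_pos (by omega), if_neg (by omega)]
    have e2 : (n - (n + 1 - 1)).toNat = 0 := by omega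
    rw [e2, zpow_sub_one₀ ha]
    simp
    field_simp
  · rw [if_neg (by omega), if_neg (by omega), if_neg (by omega)]; simp

/-- Both sides satisfy the same recursion in `n` and agree at `n = 0`; negative exponents are
reached by dividing by `lin g`. From here on the exponent laws for the binomial expansions are those
of a field. -/
theorem toField_linPow (g : LinPoly) (n : ℤ) : toField (LaurentInf.linPow g n) = lin g ^ n := by
  have hs : ∀ n, toField (LaurentInf.linPow g (n + 1))
      = lin g * toField (LaurentInf.linPow g n) := fun n => LaurentField.ext_cf fun m => by
    rw [lin, add_mul, LaurentField.cf_add, mul_assoc, cf_const_mul, cf_const_mul, cf_var_mul,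
      cf_toField, cf_toField, cf_toField, linPow_succ]
  have hg := lin_ne_zero g
  induction n using Int.induction_on with
  | zero =>
    rw [zpow_zero]
    refine LaurentField.ext_cf fun m => ?_
    rw [cf_toField, linPow_apply, cf_one]
    rcases lt_trichotomy m 0 with h | h | h
    · rw [if_pos (by omega), if_neg (by omega)]
      obtain ⟨k, hk⟩ : ∃ k : ℕ, (0 - m).toNat = k + 1 := ⟨(-m).toNat - 1, by omega⟩
      rw [hk, Ring.choose_zero_succ]; simp
    · simp [h]
    · rw [if_neg (by omega), if_neg (by omega)]
  | succ n ih => rw [hs, ih, zpow_add_one₀ hg, mul_comm]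
  | pred n ih =>
    have h := hs (-n - 1)
    rw [sub_add_cancel, ih] at h
    rw [zpow_sub_one₀ hg, h]
    field_simp

theorem deriv_linPow (g : LinPoly) (n : ℤ) : LaurentInf.deriv (LaurentInf.linPow g n)
    = ((n : ℂ) * g.a) • LaurentInf.linPow g (n - 1) := by
  ext m
  change ((m : ℂ) + 1) * (LaurentInf.linPow g n).1 (m + 1)
    = ((n : ℂ) * g.a) * (LaurentInf.linPow g (n - 1)).1 m
  simp only [linPow_apply]
  have ha : (g.a : ℂ) ≠ 0 := g.a.ne_zero
  rcases lt_or_ge m n with h | h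
  · obtain ⟨i, rfl⟩ : ∃ i : ℕ, n = m + 1 + i := ⟨(n - m - 1).toNat, by omega⟩
    rw [if_pos (by omega), if_pos (by omega)]
    have e1 : (m + 1 + i - (m + 1)).toNat = i := by omega
    have e2 : (m + 1 + i - 1 - m).toNat = i := by omega
    have h1 := (Ring.succ_mul_choose_succ (m + 1 + i) i).symm.trans
      (Ring.succ_mul_choose_succ' (m + 1 + i) i)
    have h2 := congrArg (Int.cast : ℤ → ℂ) h1
    push_cast at h2
    rw [e1, e2, zpow_add_one₀ ha]
    push_cast
    linear_combination ((g.a : ℂ) ^ m * g.a * g.b ^ i) * h2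
  · rw [if_neg (by omega), if_neg (by omega)]; simp

theorem deriv_pow_linPow (g : LinPoly) (n : ℤ) (j : ℕ) :
    (LaurentInf.deriv ^ j) (LaurentInf.linPow g n)
      = ((j.factorial : ℂ) * ((Ring.choose n j : ℤ) : ℂ) * (g.a : ℂ) ^ j) •
        LaurentInf.linPow g (n - j) := by
  induction j with
  | zero => simp
  | succ j ih =>
    rw [pow_succ', Module.End.mul_apply, ih, map_smul, deriv_linPow, smul_smul]
    have h2 := congrArg (Int.cast : ℤ → ℂ) (Ring.succ_mul_choose_succ n j)
    push_cast at h2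
    have e : n - (j : ℤ) - 1 = n - ((j + 1 : ℕ) : ℤ) := by push_cast; ring
    rw [e]
    congr 1
    rw [Nat.factorial_succ]
    push_cast
    linear_combination (-(j.factorial : ℂ) * (g.a : ℂ) ^ (j + 1)) * h2

theorem deriv_pow_apply (f : LaurentInf) (j : ℕ) (n : ℤ) :
    ((LaurentInf.deriv ^ j) f).1 n
      = (j.factorial : ℂ) * ((Ring.choose (n + j) j : ℤ) : ℂ) * f.1 (n + j) := by
  induction j generalizing f with
  | zero => simp
  | succ j ih =>
    rw [pow_succ, Module.End.mul_apply, ih]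
    change _ * ((((n + j : ℤ) : ℂ) + 1) * f.1 (n + j + 1)) = _
    have h2 := congrArg (Int.cast : ℤ → ℂ) (Ring.succ_mul_choose_succ' (n + (j + 1 : ℕ)) j)
    have e : n + ((j + 1 : ℕ) : ℤ) - 1 = n + j := by push_cast; ring
    have e' : n + (j : ℤ) + 1 = n + ((j + 1 : ℕ) : ℤ) := by push_cast; ring
    rw [e] at h2
    rw [e']
    push_cast at h2
    rw [Nat.factorial_succ]
    push_cast
    linear_combination (-(j.factorial : ℂ) * f.1 (n + (j + 1))) * h2

/-- The coefficient of `x ^ (l - i)` in `(1 / i!) (d/dx) ^ i g(x) ^ k`, computed once term by term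
and once by the chain rule. It is the identity behind the Taylor expansion in `substAdd_substFirst`.
-/
theorem choose_mul_linPow (g : LinPoly) (k l : ℤ) (i : ℕ) :
    ((Ring.choose l i : ℤ) : ℂ) * (LaurentInf.linPow g k).1 l
      = ((Ring.choose k i : ℤ) : ℂ) * (g.a : ℂ) ^ i * (LaurentInf.linPow g (k - i)).1 (l - i) := by
  have h1 := deriv_pow_apply (LaurentInf.linPow g k) i (l - i)
  rw [deriv_pow_linPow, sub_add_cancel] at h1
  change _ * (LaurentInf.linPow g (k - i)).1 (l - i) = _ at h1
  have h3 : (i.factorial : ℂ) ≠ 0 := by exact_mod_cast i.factorial_ne_zero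
  apply mul_left_cancel₀ h3
  linear_combination -h1

/-- The vector `a(x) w` of `W((x⁻¹))`. -/
def vec (a : FieldAtInf W) (w : W) : InfModule W := ofFun fun n => a.1 n w

theorem cf_vec (a : FieldAtInf W) (w : W) (n : ℤ) : cf n (vec a w) = a.1 n w :=
  cf_ofFun (a.2 w) n

theorem cf_toField_smul_vec (f : LaurentInf) (a : FieldAtInf W) (w : W) (n : ℤ) :
    cf n (toField f • vec a w) = (FieldAtInf.lmul f a).1 n w := by
  rw [cf_smul]
  simp only [cf_toField, cf_vec]
  rfl

/-- Chain rule: differentiating `j` times in `x₂` instead of in the value `g` costs a factor `a ^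
j`. -/
theorem mulDelta_apply (a : FieldAtInf W) (j : ℕ) (g : LinPoly) (m n : ℤ) (w : W) :
    FieldAtInf.mulDelta a j g m n w
      = cf n (ShiftSeq.deltaTerm (lin g) j (const ((g.a : ℂ) ^ j) • vec a w) m) := by
  have h3 : (j.factorial : ℂ) ≠ 0 := by exact_mod_cast j.factorial_ne_zero
  rw [FieldAtInf.mulDelta, ← cf_toField_smul_vec, deriv_pow_linPow, smul_smul, toField_smul,
    toField_linPow, ShiftSeq.deltaTerm_apply, smul_smul, ← map_intCast const,
    mul_right_comm (const _), ← map_mul]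
  congr 4
  field_simp

end InfSeries

/-! ### Vector-valued series in two variables -/

namespace BiSeries

open MvPolynomial InfSeries

variable {W : Type*} [AddCommGroup W] [Module ℂ W]

variable (W) in
/-- Multiplication of series in two variables by monomials. -/
def mono : Multiplicative (Fin 2 →₀ ℕ) →* Module.End ℂ (ℤ → ℤ → W) where
  toFun s :=
    { toFun := fun A m n => A (m - (s.toAdd 0 : ℤ)) (n - (s.toAdd 1 : ℤ))
      map_add' := fun _ _ => rfl
      map_smul' := fun _ _ => rfl }
  map_one' := by ext A : 1; funext m n; simp
  map_mul' s t := by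
    ext A : 1
    funext m n
    simp only [toAdd_mul, Finsupp.add_apply, Nat.cast_add, LinearMap.coe_mk, AddHom.coe_mk,
      Module.End.mul_apply]
    congr 1 <;> ring

variable (W) in
/-- Multiplication of series in two variables by polynomials. -/
def op : MvPolynomial (Fin 2) ℂ →ₐ[ℂ] Module.End ℂ (ℤ → ℤ → W) :=
  AddMonoidAlgebra.lift ℂ _ _ (mono W)

theorem op_apply (p : MvPolynomial (Fin 2) ℂ) (A : ℤ → ℤ → W) (m n : ℤ) :
    op W p A m n = ∑ s ∈ p.support, p.coeff s • A (m - (s 0 : ℤ)) (n - (s 1 : ℤ)) := by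
  rw [op, AddMonoidAlgebra.lift_apply, Finsupp.sum, LinearMap.sum_apply, Finset.sum_apply,
    Finset.sum_apply]
  rfl

theorem op_monomial (s : Fin 2 →₀ ℕ) (A : ℤ → ℤ → W) (m n : ℤ) :
    op W (monomial s 1) A m n = A (m - (s 0 : ℤ)) (n - (s 1 : ℤ)) := by
  rw [op_apply, support_monomial, if_neg one_ne_zero, Finset.sum_singleton, coeff_monomial,
    if_pos rfl, one_smul]

theorem op_X0 (A : ℤ → ℤ → W) (m n : ℤ) : op W (X 0) A m n = A (m - 1) n := by
  rw [X, op_monomial]; simp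

theorem op_X1 (A : ℤ → ℤ → W) (m n : ℤ) : op W (X 1) A m n = A m (n - 1) := by
  rw [X, op_monomial]; simp

theorem op_C (c : ℂ) (A : ℤ → ℤ → W) : op W (C c) A = c • A := by
  rw [← algebraMap_eq, AlgHom.commutes, Module.algebraMap_end_apply]

theorem op_mul (p q : MvPolynomial (Fin 2) ℂ) (A : ℤ → ℤ → W) :
    op W (p * q) A = op W p (op W q A) := by
  rw [map_mul, Module.End.mul_apply]

theorem op_add (p q : MvPolynomial (Fin 2) ℂ) (A : ℤ → ℤ → W) :
    op W (p + q) A = op W p A + op W q A := by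
  rw [map_add, LinearMap.add_apply]

theorem op_factor (h : LinPoly) (A : ℤ → ℤ → W) (m n : ℤ) :
    op W h.factor A m n = A (m - 1) n - ((h.a : ℂ) • A m (n - 1) + h.b • A m n) := by
  rw [LinPoly.factor, map_sub, LinearMap.sub_apply, op_add, op_mul, op_C, op_C]
  simp only [Pi.sub_apply, Pi.add_apply, Pi.smul_apply, op_X0, op_X1]

theorem polyMul_apply (p : MvPolynomial (Fin 2) ℂ) (A : Series₂ W) (m n : ℤ) (w : W) :
    Series₂.polyMul p A m n w = op W p (fun m n => A m n w) m n := by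
  rw [op_apply, Series₂.polyMul, LinearMap.sum_apply]
  rfl

/-- A subspace stable under multiplication by the variables is stable under polynomials. -/
theorem op_mem (P : Submodule ℂ (ℤ → ℤ → W)) (h0 : ∀ A ∈ P, op W (X 0) A ∈ P)
    (h1 : ∀ A ∈ P, op W (X 1) A ∈ P) (p : MvPolynomial (Fin 2) ℂ) :
    ∀ A ∈ P, op W p A ∈ P := by
  induction p using MvPolynomial.induction_on with
  | C a => intro A hA; rw [op_C]; exact P.smul_mem a hA
  | add p q hp hq => intro A hA; rw [op_add]; exact P.add_mem (hp A hA) (hq A hA)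
  | mul_X p i ih =>
    intro A hA
    rw [op_mul]
    fin_cases i
    · exact ih _ (h0 A hA)
    · exact ih _ (h1 A hA)

/-! ### Support conditions on series in two variables -/

variable (W) in
/-- Series in which the powers of both variables are bounded above. -/
def trunc : Submodule ℂ (ℤ → ℤ → W) where
  carrier := {A | ∃ N : ℤ, ∀ m n : ℤ, N < m ∨ N < n → A m n = 0}
  add_mem' := by
    rintro A B ⟨N, hN⟩ ⟨M, hM⟩
    refine ⟨max N M, fun m n h => ?_⟩
    rw [Pi.add_apply, Pi.add_apply, hN m n (by omega), hM m n (by omega), add_zero]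
  zero_mem' := ⟨0, fun _ _ _ => rfl⟩
  smul_mem' := by
    rintro c A ⟨N, hN⟩
    exact ⟨N, fun m n h => by rw [Pi.smul_apply, Pi.smul_apply, hN m n h, smul_zero]⟩

theorem op_mem_trunc (p : MvPolynomial (Fin 2) ℂ) {A : ℤ → ℤ → W} (hA : A ∈ trunc W) :
    op W p A ∈ trunc W := by
  refine op_mem _ ?_ ?_ p A hA
  · rintro A ⟨N, hN⟩
    exact ⟨N + 1, fun m n h => by rw [op_X0]; exact hN _ _ (by omega)⟩
  · rintro A ⟨N, hN⟩
    exact ⟨N + 1, fun m n h => by rw [op_X1]; exact hN _ _ (by omega)⟩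

variable (W) in
/-- Series in which, for each power of the second variable, the powers of the first variable are
bounded above. -/
def colBdd : Submodule ℂ (ℤ → ℤ → W) where
  carrier := {A | ∀ n, BddSupp fun m => A m n}
  add_mem' := fun ha hb n => (ha n).add (hb n)
  zero_mem' := fun _ => ⟨0, fun _ _ => rfl⟩
  smul_mem' := fun c _ ha n => (ha n).smul c

theorem op_mem_colBdd (p : MvPolynomial (Fin 2) ℂ) {A : ℤ → ℤ → W} (hA : A ∈ colBdd W) :
    op W p A ∈ colBdd W := by
  refine op_mem _ ?_ ?_ p A hA
  · intro A hA n
    simp only [op_X0]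
    exact (hA n).shift 1
  · intro A hA n
    simp only [op_X1]
    exact hA (n - 1)

variable (W) in
/-- Series in which, for each power of the first variable, the powers of the second variable are
bounded above. -/
def rowBdd : Submodule ℂ (ℤ → ℤ → W) where
  carrier := {A | ∀ m, BddSupp (A m)}
  add_mem' := fun ha hb n => (ha n).add (hb n)
  zero_mem' := fun _ => ⟨0, fun _ _ => rfl⟩
  smul_mem' := fun c _ ha n => (ha n).smul c

theorem op_mem_rowBdd (p : MvPolynomial (Fin 2) ℂ) {A : ℤ → ℤ → W} (hA : A ∈ rowBdd W) :
    op W p A ∈ rowBdd W := by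
  refine op_mem _ ?_ ?_ p A hA
  · intro A hA m
    have : op W (X 0) A m = A (m - 1) := funext fun n => op_X0 A m n
    rw [this]
    exact hA _
  · intro A hA m
    have : op W (X 1) A m = fun n => A m (n - 1) := funext fun n => op_X1 A m n
    rw [this]
    exact (hA m).shift 1

theorem trunc_le_rowBdd : trunc W ≤ rowBdd W := fun _ ⟨N, hN⟩ m =>
  ⟨N, fun n hn => hN m n (Or.inr hn)⟩

variable (W) in
/-- Series in which the powers of the second variable are bounded above. -/
def sndBdd : Submodule ℂ (ℤ → ℤ → W) where
  carrier := {A | ∃ N : ℤ, ∀ m n : ℤ, N < n → A m n = 0}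
  add_mem' := by
    rintro A B ⟨N, hN⟩ ⟨M, hM⟩
    refine ⟨max N M, fun m n h => ?_⟩
    rw [Pi.add_apply, Pi.add_apply, hN m n (by omega), hM m n (by omega), add_zero]
  zero_mem' := ⟨0, fun _ _ _ => rfl⟩
  smul_mem' := by
    rintro c A ⟨N, hN⟩
    exact ⟨N, fun m n h => by rw [Pi.smul_apply, Pi.smul_apply, hN m n h, smul_zero]⟩

theorem op_mem_sndBdd (p : MvPolynomial (Fin 2) ℂ) {A : ℤ → ℤ → W} (hA : A ∈ sndBdd W) :
    op W p A ∈ sndBdd W := by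
  refine op_mem _ ?_ ?_ p A hA
  · rintro A ⟨N, hN⟩
    exact ⟨N, fun m n h => by rw [op_X0]; exact hN _ _ h⟩
  · rintro A ⟨N, hN⟩
    exact ⟨N + 1, fun m n h => by rw [op_X1]; exact hN _ _ (by omega)⟩

variable (W) in
/-- Series in which the powers of the first variable are bounded above. -/
def fstBdd : Submodule ℂ (ℤ → ℤ → W) where
  carrier := {A | ∃ N : ℤ, ∀ m n : ℤ, N < m → A m n = 0}
  add_mem' := by
    rintro A B ⟨N, hN⟩ ⟨M, hM⟩
    refine ⟨max N M, fun m n h => ?_⟩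
    rw [Pi.add_apply, Pi.add_apply, hN m n (by omega), hM m n (by omega), add_zero]
  zero_mem' := ⟨0, fun _ _ _ => rfl⟩
  smul_mem' := by
    rintro c A ⟨N, hN⟩
    exact ⟨N, fun m n h => by rw [Pi.smul_apply, Pi.smul_apply, hN m n h, smul_zero]⟩

theorem op_mem_fstBdd (p : MvPolynomial (Fin 2) ℂ) {A : ℤ → ℤ → W} (hA : A ∈ fstBdd W) :
    op W p A ∈ fstBdd W := by
  refine op_mem _ ?_ ?_ p A hA
  · rintro A ⟨N, hN⟩
    exact ⟨N + 1, fun m n h => by rw [op_X0]; exact hN _ _ (by omega)⟩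
  · rintro A ⟨N, hN⟩
    exact ⟨N, fun m n h => by rw [op_X1]; exact hN _ _ h⟩

theorem mem_trunc_of_mem {A : ℤ → ℤ → W} (h1 : A ∈ fstBdd W) (h2 : A ∈ sndBdd W) :
    A ∈ trunc W := by
  obtain ⟨N, hN⟩ := h1
  obtain ⟨M, hM⟩ := h2
  refine ⟨max N M, fun m n h => ?_⟩
  rcases h with h | h
  · exact hN _ _ (by omega)
  · exact hM _ _ (by omega)

variable (W) in
/-- Series in which the powers of the first variable are bounded below and, for each power of the
first variable, the powers of the second variable are bounded above: `W((x₂⁻¹))((x₀))`. -/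
def lowBdd : Submodule ℂ (ℤ → ℤ → W) where
  carrier := {A | (∃ J : ℕ, ∀ i : ℤ, i < -(J : ℤ) → A i = 0) ∧ A ∈ rowBdd W}
  add_mem' := by
    rintro A B ⟨⟨N, hN⟩, hA⟩ ⟨⟨M, hM⟩, hB⟩
    refine ⟨⟨max N M, fun m h => ?_⟩, (rowBdd W).add_mem hA hB⟩
    rw [Pi.add_apply, hN m (by omega), hM m (by omega), add_zero]
  zero_mem' := ⟨⟨0, fun _ _ => rfl⟩, (rowBdd W).zero_mem⟩
  smul_mem' := by
    rintro c A ⟨⟨N, hN⟩, hA⟩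
    exact ⟨⟨N, fun m h => by rw [Pi.smul_apply, hN m h, smul_zero]⟩, (rowBdd W).smul_mem c hA⟩

theorem op_mem_lowBdd (p : MvPolynomial (Fin 2) ℂ) {A : ℤ → ℤ → W} (hA : A ∈ lowBdd W) :
    op W p A ∈ lowBdd W := by
  refine op_mem _ ?_ ?_ p A hA
  · rintro A ⟨⟨N, hN⟩, hA⟩
    refine ⟨⟨N, fun m h => ?_⟩, op_mem_rowBdd _ hA⟩
    funext n
    rw [op_X0, hN _ (by omega)]
  · rintro A ⟨⟨N, hN⟩, hA⟩
    refine ⟨⟨N, fun m h => ?_⟩, op_mem_rowBdd _ hA⟩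
    funext n
    rw [op_X1, hN _ h]; rfl

/-- Nonzero polynomials are cancellable on `W((x₂⁻¹))((x₀))`. -/
theorem eq_zero_of_op_eq_zero {p : MvPolynomial (Fin 2) ℂ} (hp : p ≠ 0) {Y : ℤ → ℤ → W}
    (hY : Y ∈ lowBdd W) (h : op W p Y = 0) : Y = 0 := by
  by_contra hne
  obtain ⟨⟨J, hJ⟩, hrow⟩ := hY
  obtain ⟨i0, hi0, hmin⟩ : ∃ i0, Y i0 ≠ 0 ∧ ∀ i, Y i ≠ 0 → i0 ≤ i := by
    obtain ⟨i, hi⟩ : ∃ i, Y i ≠ 0 := by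
      by_contra hc; push Not at hc; exact hne (funext hc)
    exact Int.exists_least_of_bdd (P := fun i => Y i ≠ 0)
      ⟨-J, fun z hz => by by_contra hc; exact hz (hJ z (by omega))⟩ ⟨i, hi⟩
  obtain ⟨k0, hk0, hmax⟩ : ∃ k0, Y i0 k0 ≠ 0 ∧ ∀ k, Y i0 k ≠ 0 → k ≤ k0 := by
    obtain ⟨k, hk⟩ : ∃ k, Y i0 k ≠ 0 := by
      by_contra hc; push Not at hc; exact hi0 (funext hc)
    obtain ⟨N, hN⟩ := hrow i0
    exact Int.exists_greatest_of_bdd (P := fun k => Y i0 k ≠ 0)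
      ⟨N, fun z hz => by by_contra hc; exact hz (hN z (by omega))⟩ ⟨k, hk⟩
  -- Leading terms: the lowest power of `x₀`, and within it the highest power of `x₂`, taken in both
  -- `p` and `Y`. The product of the two leading coefficients receives no other contribution.
  obtain ⟨s, hs, hsmin⟩ := Finset.exists_min_image p.support
    (fun s => toLex ((s 0 : ℤ), -(s 1 : ℤ))) (support_nonempty.2 hp)
  have hc := congrFun (congrFun h (s 0 + i0)) (s 1 + k0)
  rw [op_apply, Finset.sum_eq_single s] at hc
  · have e1 : (s 0 : ℤ) + i0 - s 0 = i0 := by ring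
    have e2 : (s 1 : ℤ) + k0 - s 1 = k0 := by ring
    rw [e1, e2] at hc
    exact (smul_ne_zero (mem_support_iff.1 hs) hk0) hc
  · intro t ht hts
    have h1 := hsmin t ht
    rw [Prod.Lex.toLex_le_toLex] at h1
    rcases h1 with h1 | ⟨h1, h2⟩
    · have hz : Y ((s 0 : ℤ) + i0 - t 0) = 0 := by
        by_contra hc2
        have := hmin _ hc2
        simp only at h1
        omega
      rw [hz]; simp
    · simp only at h1 h2
      have h3 : s 1 ≠ t 1 := by
        intro e
        apply hts
        ext i
        fin_cases i
        · exact_mod_cast h1.symm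
        · exact e.symm
      have e : (s 0 : ℤ) + i0 - t 0 = i0 := by omega
      have hz : Y i0 ((s 1 : ℤ) + k0 - t 1) = 0 := by
        by_contra hc2
        have := hmax _ hc2
        omega
      rw [e, hz, smul_zero]
  · intro hs'; exact absurd hs hs'

/-! ### The substitution `x₁ = x₂ + x₀` -/

theorem shiftFirst_ne_zero {p : MvPolynomial (Fin 2) ℂ} (hp : p ≠ 0) : p.shiftFirst ≠ 0 := by
  intro h
  have key : (aeval ![(X 0 - X 1 : MvPolynomial (Fin 2) ℂ), X 1]).comp
      (aeval ![(X 0 + X 1 : MvPolynomial (Fin 2) ℂ), X 1]) = AlgHom.id ℂ _ := by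
    apply MvPolynomial.algHom_ext
    intro i
    rw [AlgHom.comp_apply, aeval_X, AlgHom.id_apply]
    fin_cases i
    · change aeval _ (X 0 + X 1 : MvPolynomial (Fin 2) ℂ) = X 0
      rw [map_add, aeval_X, aeval_X]
      exact sub_add_cancel _ _
    · exact aeval_X _ _
  have h1 := AlgHom.congr_fun key p
  rw [AlgHom.comp_apply, AlgHom.id_apply] at h1
  exact hp (h1.symm.trans ((congrArg _ h).trans (map_zero _)))

theorem shiftFirst_mul (p q : MvPolynomial (Fin 2) ℂ) :
    (p * q).shiftFirst = p.shiftFirst * q.shiftFirst := map_mul _ _ _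

theorem shiftFirst_add (p q : MvPolynomial (Fin 2) ℂ) :
    (p + q).shiftFirst = p.shiftFirst + q.shiftFirst := map_add _ _ _

theorem shiftFirst_C (c : ℂ) : (C c : MvPolynomial (Fin 2) ℂ).shiftFirst = C c := by
  simp [shiftFirst]

theorem shiftFirst_X0 : (X 0 : MvPolynomial (Fin 2) ℂ).shiftFirst = X 0 + X 1 := by
  simp [shiftFirst]

theorem shiftFirst_X1 : (X 1 : MvPolynomial (Fin 2) ℂ).shiftFirst = X 1 := by
  simp [shiftFirst]

/-- The series `A(x₂ + x₀, x₂)`. -/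
def substAdd (A : ℤ → ℤ → W) (i k : ℤ) : W :=
  if 0 ≤ i then ∑ᶠ m : ℤ, ((Ring.choose m i.toNat : ℤ) : ℂ) • A m (k + i - m) else 0

theorem finite_support_antidiag {A : ℤ → ℤ → W} (hA : A ∈ trunc W) (c : ℤ → ℂ) (k : ℤ) :
    (Function.support fun m : ℤ => c m • A m (k - m)).Finite := by
  obtain ⟨N, hN⟩ := hA
  refine (Set.finite_Icc (k - N) N).subset fun m hm => ?_
  by_contra hc
  rw [Set.mem_Icc] at hc
  exact hm (by simp only [hN m (k - m) (by omega), smul_zero])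

theorem substAdd_add {A B : ℤ → ℤ → W} (hA : A ∈ trunc W) (hB : B ∈ trunc W) :
    substAdd (A + B) = substAdd A + substAdd B := by
  funext i k
  simp only [substAdd, Pi.add_apply]
  split_ifs
  · simp only [smul_add]
    exact finsum_add_distrib (finite_support_antidiag hA _ _) (finite_support_antidiag hB _ _)
  · simp

theorem substAdd_smul {A : ℤ → ℤ → W} (hA : A ∈ trunc W) (c : ℂ) :
    substAdd (c • A) = c • substAdd A := by
  funext i k
  simp only [substAdd, Pi.smul_apply]
  split_ifs
  · rw [smul_finsum' c (finite_support_antidiag hA _ _)]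
    simp only [smul_comm c]
  · simp

/-- Pascal's rule for `(x₂ + x₀) ^ (m + 1)`. The power `i = 0` is separate because the term with `x₀
^ (i - 1)` is then absent. -/
theorem substAdd_X0 {A : ℤ → ℤ → W} (hA : A ∈ trunc W) :
    substAdd (op W (X 0) A) = op W (X 0 + X 1) (substAdd A) := by
  funext i k
  rw [op_add, Pi.add_apply, Pi.add_apply, op_X0, op_X1]
  simp only [substAdd, op_X0]
  rcases lt_trichotomy i 0 with h | h | h
  · rw [if_neg (by omega), if_neg (by omega), if_neg (by omega), add_zero]
  · subst h
    rw [if_pos le_rfl, if_neg (by omega), if_pos le_rfl, zero_add,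
      ← finsum_comp_equiv (Equiv.addRight (1 : ℤ))]
    refine finsum_congr fun m => ?_
    simp only [Equiv.coe_addRight, Int.toNat_zero, Ring.choose_zero_right]
    congr 2 <;> ring
  · obtain ⟨j, rfl⟩ : ∃ j : ℕ, i = j + 1 := ⟨(i - 1).toNat, by omega⟩
    rw [if_pos (by omega), if_pos (by omega), if_pos (by omega),
      ← finsum_comp_equiv (Equiv.addRight (1 : ℤ)),
      ← finsum_add_distrib (finite_support_antidiag hA _ _) (finite_support_antidiag hA _ _)]
    refine finsum_congr fun m => ?_
    have e1 : ((j : ℤ) + 1).toNat = j + 1 := by omega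
    have e2 : ((j : ℤ) + 1 - 1).toNat = j := by omega
    have e3 : m + 1 - 1 = m := by ring
    have e4 : k + ((j : ℤ) + 1) - (m + 1) = k + j - m := by ring
    have e5 : k + ((j : ℤ) + 1 - 1) - m = k + j - m := by ring
    have e6 : k - 1 + ((j : ℤ) + 1) - m = k + j - m := by ring
    simp only [Equiv.coe_addRight, e1, e2, e3, e4, e5, e6, ← add_smul, Ring.cast_choose_succ_succ]

theorem substAdd_X1 (A : ℤ → ℤ → W) :
    substAdd (op W (X 1) A) = op W (X 1) (substAdd A) := by
  funext i k
  rw [op_X1]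
  simp only [substAdd, op_X1]
  have e : ∀ m, k + i - m - 1 = k - 1 + i - m := fun m => by ring
  simp only [e]

theorem substAdd_op (p : MvPolynomial (Fin 2) ℂ) : ∀ {A : ℤ → ℤ → W}, A ∈ trunc W →
    substAdd (op W p A) = op W p.shiftFirst (substAdd A) := by
  induction p using MvPolynomial.induction_on with
  | C a => intro A hA; rw [op_C, shiftFirst_C, op_C, substAdd_smul hA]
  | add p q hp hq =>
    intro A hA
    rw [op_add, shiftFirst_add, op_add, substAdd_add (op_mem_trunc p hA) (op_mem_trunc q hA),
      hp hA, hq hA]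
  | mul_X p i ih =>
    intro A hA
    rw [op_mul, shiftFirst_mul, op_mul, ih (op_mem_trunc _ hA)]
    fin_cases i
    · change _ = op W p.shiftFirst (op W (X 0 : MvPolynomial (Fin 2) ℂ).shiftFirst (substAdd A))
      rw [shiftFirst_X0, ← substAdd_X0 hA]; rfl
    · change _ = op W p.shiftFirst (op W (X 1 : MvPolynomial (Fin 2) ℂ).shiftFirst (substAdd A))
      rw [shiftFirst_X1, ← substAdd_X1]; rfl

theorem substAdd_mem_lowBdd {A : ℤ → ℤ → W} (hA : A ∈ trunc W) : substAdd A ∈ lowBdd W := by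
  refine ⟨⟨0, fun i hi => ?_⟩, fun i => ?_⟩
  · funext k
    rw [substAdd, if_neg (by simpa using hi)]; rfl
  · obtain ⟨N, hN⟩ := hA
    refine ⟨2 * N - i, fun k hk => ?_⟩
    rw [substAdd]
    split_ifs
    · rw [← finsum_zero (α := ℤ)]
      refine finsum_congr fun m => ?_
      rw [hN m _ (by omega), smul_zero]
    · rfl

/-! ### Substitution of a linear polynomial for the first variable -/

/-- The series `A(g(x₁), x₂)`. -/
def substFirst (g : LinPoly) (A : ℤ → ℤ → W) (m n : ℤ) : W :=
  ∑ᶠ k : ℤ, (LaurentInf.linPow g k).1 m • A k n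

theorem linPow_eq_zero (g : LinPoly) {k m : ℤ} (h : k < m) : (LaurentInf.linPow g k).1 m = 0 := by
  rw [linPow_apply, if_neg (by omega)]

theorem finite_support_substFirst (g : LinPoly) {A : ℤ → ℤ → W} (hA : A ∈ colBdd W) (m n : ℤ) :
    (Function.support fun k : ℤ => (LaurentInf.linPow g k).1 m • A k n).Finite := by
  obtain ⟨N, hN⟩ := hA n
  refine (Set.finite_Icc m N).subset fun k hk => ?_
  by_contra hc
  rw [Set.mem_Icc, not_and_or, not_le, not_le] at hc
  rcases hc with hc | hc
  · exact hk (by simp only [linPow_eq_zero g hc, zero_smul])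
  · exact hk (by simp only [hN k hc, smul_zero])

theorem substFirst_X0 (g : LinPoly) {A : ℤ → ℤ → W} (hA : A ∈ colBdd W) :
    substFirst g (op W (X 0) A) = op W (C (g.a : ℂ) * X 0 + C g.b) (substFirst g A) := by
  funext m n
  have hfin : ∀ (c : ℂ) (m' : ℤ), (Function.support fun k : ℤ =>
      c • (LaurentInf.linPow g k).1 m' • A k n).Finite := fun c m' =>
    (finite_support_substFirst g hA m' n).subset fun k hk hc => hk (by simp only [hc, smul_zero])
  rw [op_add, op_mul, op_C, op_C]
  simp only [Pi.add_apply, Pi.smul_apply, op_X0, substFirst]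
  rw [smul_finsum' _ (finite_support_substFirst g hA _ _),
    smul_finsum' _ (finite_support_substFirst g hA _ _),
    ← finsum_add_distrib (hfin _ _) (hfin _ _),
    ← finsum_comp_equiv (Equiv.addRight (1 : ℤ))]
  refine finsum_congr fun k => ?_
  simp only [Equiv.coe_addRight, linPow_succ, add_smul, mul_smul, add_sub_cancel_right]

theorem substFirst_sub (g : LinPoly) {A B : ℤ → ℤ → W} (hA : A ∈ colBdd W) (hB : B ∈ colBdd W) :
    substFirst g (A - B) = substFirst g A - substFirst g B := by
  funext m n
  simp only [substFirst, Pi.sub_apply, smul_sub]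
  exact finsum_sub_distrib (finite_support_substFirst g hA _ _)
    (finite_support_substFirst g hB _ _)

theorem substFirst_add (g : LinPoly) {A B : ℤ → ℤ → W} (hA : A ∈ colBdd W) (hB : B ∈ colBdd W) :
    substFirst g (A + B) = substFirst g A + substFirst g B := by
  funext m n
  simp only [substFirst, Pi.add_apply, smul_add]
  exact finsum_add_distrib (finite_support_substFirst g hA _ _)
    (finite_support_substFirst g hB _ _)

theorem substFirst_smul (g : LinPoly) {A : ℤ → ℤ → W} (hA : A ∈ colBdd W) (c : ℂ) :
    substFirst g (c • A) = c • substFirst g A := by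
  funext m n
  simp only [substFirst, Pi.smul_apply]
  rw [smul_finsum' c (finite_support_substFirst g hA _ _)]
  simp only [smul_comm c]

theorem substFirst_X1 (g : LinPoly) (A : ℤ → ℤ → W) :
    substFirst g (op W (X 1) A) = op W (X 1) (substFirst g A) := by
  funext m n
  simp only [op_X1, substFirst]

/-- The polynomial `g(x₁) - h(x₂)`. -/
def linFactor (g h : LinPoly) : MvPolynomial (Fin 2) ℂ :=
  C (g.a : ℂ) * X 0 + C g.b - (C (h.a : ℂ) * X 1 + C h.b)

theorem substFirst_factor (g h : LinPoly) {A : ℤ → ℤ → W} (hA : A ∈ colBdd W) :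
    substFirst g (op W h.factor A) = op W (linFactor g h) (substFirst g A) := by
  have h1 := op_mem_colBdd (X 0) hA
  have h2 := op_mem_colBdd (X 1) hA
  rw [linFactor, LinPoly.factor, map_sub, map_sub, LinearMap.sub_apply, LinearMap.sub_apply,
    ← substFirst_X0 g hA, op_add, op_add, op_mul, op_mul, op_C, op_C, op_C, op_C,
    substFirst_sub g h1 ((colBdd W).add_mem ((colBdd W).smul_mem _ h2) ((colBdd W).smul_mem _ hA)),
    substFirst_add g ((colBdd W).smul_mem _ h2) ((colBdd W).smul_mem _ hA),
    substFirst_smul g h2, substFirst_smul g hA, substFirst_X1]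

theorem substFirst_prod_factor (g : LinPoly) (s : Multiset LinPoly) {A : ℤ → ℤ → W}
    (hA : A ∈ colBdd W) : substFirst g (op W (s.map LinPoly.factor).prod A)
      = op W (s.map (linFactor g)).prod (substFirst g A) := by
  induction s using Multiset.induction_on with
  | empty => simp
  | cons h s ih =>
    rw [Multiset.map_cons, Multiset.prod_cons, Multiset.map_cons, Multiset.prod_cons, op_mul,
      op_mul, substFirst_factor g h (op_mem_colBdd _ hA), ih]

theorem substFirst_mem_trunc (g : LinPoly) {A : ℤ → ℤ → W} (hA : A ∈ trunc W) :
    substFirst g A ∈ trunc W := by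
  obtain ⟨N, hN⟩ := hA
  refine ⟨N, fun m n h => ?_⟩
  rw [substFirst, ← finsum_zero (α := ℤ)]
  refine finsum_congr fun k => ?_
  rcases lt_or_ge k m with hk | hk
  · rw [linPow_eq_zero g hk, zero_smul]
  · rw [hN k n (by omega), smul_zero]

end BiSeries

/-! ### Moments of sequences in `W((x⁻¹))` -/

namespace InfSeries

open ShiftSeq BiSeries Polynomial

variable {W : Type*} [AddCommGroup W] [Module ℂ W]

theorem cf_lin_zpow_smul (g : LinPoly) (e : ℤ) (h : InfModule W) (n : ℤ) :
    cf n (lin g ^ e • h) = ∑ᶠ k : ℤ, (LaurentInf.linPow g e).1 k • cf (n - k) h := by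
  rw [cf_smul, ← toField_linPow]
  simp only [cf_toField]

theorem cf_lin_zpow_smul_eq_zero (g : LinPoly) (e : ℤ) {h : InfModule W} {N : ℤ}
    (hN : ∀ n, N < n → cf n h = 0) {n : ℤ} (hn : N + e < n) : cf n (lin g ^ e • h) = 0 := by
  rw [cf_lin_zpow_smul, ← finsum_zero (α := ℤ)]
  refine finsum_congr fun k => ?_
  rcases lt_or_ge e k with hk | hk
  · rw [linPow_eq_zero g hk, zero_smul]
  · rw [hN _ (by omega), smul_zero]

/-- The sum `∑ m, ε m * (m choose j) g(x) ^ (m - j) A m`, as a function of the power of `x`. -/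
def moment (ε : ℤ → ℂ) (g : LinPoly) (j : ℕ) (A : ℤ → InfModule W) (n : ℤ) : W :=
  ∑ᶠ m : ℤ, (ε m * ((Ring.choose m j : ℤ) : ℂ)) • cf n (lin g ^ (m - j) • A m)

/-- The sums `∑ m, ε m g(x) ^ (m + l) A m` are locally finite. -/
def MomentFinite (ε : ℤ → ℂ) (g : LinPoly) (A : ℤ → InfModule W) : Prop :=
  ∀ l n : ℤ, (Function.support fun m : ℤ => ε m • cf n (lin g ^ (m + l) • A m)).Finite

theorem MomentFinite.finite {ε : ℤ → ℂ} {g : LinPoly} {A : ℤ → InfModule W}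
    (h : MomentFinite ε g A) (c : ℤ → ℂ) (l n : ℤ) :
    (Function.support fun m : ℤ => (ε m * c m) • cf n (lin g ^ (m + l) • A m)).Finite :=
  (h l n).subset fun m hm h0 => hm (by
    have h1 : ε m • cf n (lin g ^ (m + l) • A m) = 0 := h0
    simp only [mul_comm (ε m), mul_smul, h1, smul_zero])

/-- Summation by parts. The weight may jump only between `-1` and `0`, so the reindexed half of the
sum remains finite after one exceptional index is added to the support. -/
theorem moment_shiftSub_aux {ε : ℤ → ℂ} (hε : ∀ m, m ≠ -1 → ε (m + 1) = ε m) {g : LinPoly}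
    {A : ℤ → InfModule W} (hA : MomentFinite ε g A) (j : ℕ) (n : ℤ) :
    moment ε g j (shiftSub (lin g) A) n
      = ∑ᶠ m : ℤ, (ε (m + 1) * ((Ring.choose (m + 1) j : ℤ) : ℂ)
          - ε m * ((Ring.choose m j : ℤ) : ℂ)) • cf n (lin g ^ (m + (1 - j)) • A m) := by
  have hg := lin_ne_zero g
  have f1 : (Function.support fun m : ℤ => (ε (m + 1) * ((Ring.choose (m + 1) j : ℤ) : ℂ)) •
      cf n (lin g ^ (m + (1 - j)) • A m)).Finite := by
    refine ((hA.finite (fun m => ((Ring.choose (m + 1) j : ℤ) : ℂ)) (1 - j) n).union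
      (Set.finite_singleton (-1))).subset fun m hm => ?_
    by_cases h : m = -1
    · exact Or.inr h
    · left
      rw [Function.mem_support] at hm ⊢
      rwa [hε m h] at hm
  have f1' : (Function.support fun m : ℤ => (ε m * ((Ring.choose m j : ℤ) : ℂ)) •
      cf n (lin g ^ (m - j) • A (m - 1))).Finite := by
    refine (f1.image (Equiv.addRight (1 : ℤ))).subset fun m hm => ⟨m - 1, ?_, by simp⟩
    rw [Function.mem_support] at hm ⊢
    have e : m - 1 + (1 - (j : ℤ)) = m - j := by ring
    rwa [sub_add_cancel, e]
  have f2 := hA.finite (fun m => ((Ring.choose m j : ℤ) : ℂ)) (1 - j) n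
  simp only [sub_smul]
  rw [finsum_sub_distrib f1 f2, ← finsum_comp_equiv (Equiv.subRight (1 : ℤ))]
  have e1 : ∀ m : ℤ, (Equiv.subRight (1 : ℤ)) m = m - 1 := fun _ => rfl
  have e2 : ∀ m : ℤ, m - 1 + (1 - (j : ℤ)) = m - j := fun m => by ring
  simp only [e1, e2, sub_add_cancel]
  rw [← finsum_sub_distrib f1' f2, moment]
  refine finsum_congr fun m => ?_
  have e3 : m + (1 - (j : ℤ)) = (m - j) + 1 := by ring
  rw [shiftSub_apply, smul_sub, map_sub, smul_sub, e3, zpow_add_one₀ hg, mul_smul (lin g ^ _)]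

/-- Pascal's rule lowers the order of the moment. The jump of the weight causes no boundary term,
because `choose 0 (j + 1) = 0`. -/
theorem moment_succ_shiftSub {ε : ℤ → ℂ} (hε : ∀ m, m ≠ -1 → ε (m + 1) = ε m) {g : LinPoly}
    {A : ℤ → InfModule W} (hA : MomentFinite ε g A) (j : ℕ) (n : ℤ) :
    moment ε g (j + 1) (shiftSub (lin g) A) n = moment ε g j A n := by
  rw [moment_shiftSub_aux hε hA, moment]
  refine finsum_congr fun m => ?_
  have e : m + (1 - ((j + 1 : ℕ) : ℤ)) = m - j := by push_cast; ring
  rw [e]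
  congr 1
  by_cases h : m = -1
  · subst h
    have h1 := Ring.cast_choose_succ_succ (K := ℂ) (-1) j
    rw [neg_add_cancel, Ring.choose_zero_succ] at h1 ⊢
    push_cast at h1 ⊢
    linear_combination ε (-1) * h1
  · rw [hε m h, Ring.cast_choose_succ_succ]; ring

/-- In order zero the sum telescopes, and only the jump of the weight at `m = -1` is left. -/
theorem moment_zero_shiftSub {ε : ℤ → ℂ} (hε : ∀ m, m ≠ -1 → ε (m + 1) = ε m) {g : LinPoly}
    {A : ℤ → InfModule W} (hA : MomentFinite ε g A) (n : ℤ) :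
    moment ε g 0 (shiftSub (lin g) A) n = (ε 0 - ε (-1)) • cf n (A (-1)) := by
  rw [moment_shiftSub_aux hε hA, finsum_eq_single _ (-1)]
  · simp
  · intro m hm
    simp [hε m hm]

/-- Order `e` is lowered to zero by `e` factors `x - g`, and the last factor produces the residue.
The predicate `P` is a support condition stable under such factors: `UnifBdd` or `IdxBdd`. -/
theorem moment_pow_shiftSub {ε : ℤ → ℂ} (hε : ∀ m, m ≠ -1 → ε (m + 1) = ε m) {g : LinPoly}
    (P : (ℤ → InfModule W) → Prop) (hP : ∀ A, P A → P (shiftSub (lin g) A))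
    (hfin : ∀ A, P A → MomentFinite ε g A) {A : ℤ → InfModule W} (hA : P A) (e : ℕ) (n : ℤ) :
    moment ε g e ((shiftSub (lin g) ^ (e + 1)) A) n = (ε 0 - ε (-1)) • cf n (A (-1)) := by
  have hpow : ∀ k : ℕ, P ((shiftSub (lin g) ^ k) A) := by
    intro k
    induction k with
    | zero => exact hA
    | succ k ih => rw [pow_succ', Module.End.mul_apply]; exact hP _ ih
  induction e with
  | zero => rw [zero_add, pow_one]; exact moment_zero_shiftSub hε (hfin A hA) n
  | succ e ih =>
    rw [pow_succ', Module.End.mul_apply, moment_succ_shiftSub hε (hfin _ (hpow _)), ih]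

/-- The powers of `x` occurring in the sequence are uniformly bounded above. -/
def UnifBdd (A : ℤ → InfModule W) : Prop := ∃ N : ℤ, ∀ m n, N < n → cf n (A m) = 0

/-- The sequence vanishes for large indices. -/
def IdxBdd (A : ℤ → InfModule W) : Prop := ∃ N : ℤ, ∀ m, N < m → A m = 0

theorem UnifBdd.shiftSub {A : ℤ → InfModule W} (g : LinPoly) (hA : UnifBdd A) :
    UnifBdd (shiftSub (lin g) A) := by
  obtain ⟨N, hN⟩ := hA
  refine ⟨N + 1, fun m n hn => ?_⟩
  rw [shiftSub_apply, map_sub, cf_lin_smul, hN _ _ (by omega), hN _ _ (by omega),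
    hN _ _ (by omega)]
  simp

theorem IdxBdd.shiftSub {A : ℤ → InfModule W} (g : LinPoly) (hA : IdxBdd A) :
    IdxBdd (shiftSub (lin g) A) := by
  obtain ⟨N, hN⟩ := hA
  refine ⟨N + 1, fun m hm => ?_⟩
  rw [shiftSub_apply, hN _ (by omega), hN _ (by omega)]
  simp

/-- The indicator function of the negative integers. -/
def negInd (m : ℤ) : ℂ := if m < 0 then 1 else 0

/-- The indicator function of the nonnegative integers. -/
def nonnegInd (m : ℤ) : ℂ := if m < 0 then 0 else 1

theorem negInd_succ (m : ℤ) (hm : m ≠ -1) : negInd (m + 1) = negInd m := by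
  simp only [negInd]; congr 1; apply propext; omega

theorem nonnegInd_succ (m : ℤ) (hm : m ≠ -1) : nonnegInd (m + 1) = nonnegInd m := by
  simp only [nonnegInd]; congr 1; apply propext; omega

theorem negInd_add_nonnegInd (m : ℤ) : negInd m + nonnegInd m = 1 := by
  simp only [negInd, nonnegInd]; split_ifs <;> simp

/-- The degree of `g(x) ^ (m + l) A m` is at most `N + m + l`, which tends to `-∞` as `m` does; a
fixed power of `x` therefore meets only finitely many negative `m`. -/
theorem UnifBdd.momentFinite {A : ℤ → InfModule W} (g : LinPoly) (hA : UnifBdd A) :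
    MomentFinite negInd g A := by
  obtain ⟨N, hN⟩ := hA
  intro l n
  refine (Set.finite_Icc (n - l - N) 0).subset fun m hm => ?_
  by_contra hc
  rw [Set.mem_Icc, not_and_or, not_le, not_le] at hc
  apply hm
  rcases hc with hc | hc
  · simp only [cf_lin_zpow_smul_eq_zero g (m + l) (hN m) (show N + (m + l) < n by omega), smul_zero]
  · simp only [negInd, if_neg (show ¬ m < 0 by omega), zero_smul]

theorem IdxBdd.momentFinite {A : ℤ → InfModule W} (g : LinPoly) (hA : IdxBdd A) :
    MomentFinite nonnegInd g A := by
  obtain ⟨N, hN⟩ := hA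
  intro l n
  refine (Set.finite_Icc 0 N).subset fun m hm => ?_
  by_contra hc
  rw [Set.mem_Icc, not_and_or, not_le, not_le] at hc
  apply hm
  rcases hc with hc | hc
  · simp only [nonnegInd, if_pos hc, zero_smul]
  · simp only [hN m hc, smul_zero, map_zero]

theorem moment_negInd_add_nonnegInd {F : ℤ → InfModule W} (g : LinPoly) (h1 : UnifBdd F)
    (h2 : IdxBdd F) (j : ℕ) (n : ℤ) :
    moment negInd g j F n + moment nonnegInd g j F n = moment 1 g j F n := by
  have f1 := (h1.momentFinite g).finite (fun m => ((Ring.choose m j : ℤ) : ℂ)) (-j) n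
  have f2 := (h2.momentFinite g).finite (fun m => ((Ring.choose m j : ℤ) : ℂ)) (-j) n
  simp only [← sub_eq_add_neg] at f1 f2
  rw [moment, moment, ← finsum_add_distrib f1 f2, moment]
  refine finsum_congr fun m => ?_
  rw [← add_smul, ← add_mul, negInd_add_nonnegInd]; rfl

/-- If `(x₁ - g(x₂)) ^ (e + 1)` maps two sequences, expanded in different regions, to the same
series `F`, then the difference of their residues is a Taylor coefficient of `F` at
`x₁ = g(x₂)`. -/
theorem cf_residue_sub {A B F : ℤ → InfModule W} (g : LinPoly) (hA : UnifBdd A) (hB : IdxBdd B)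
    (e : ℕ) (hFA : (shiftSub (lin g) ^ (e + 1)) A = F) (hFB : (shiftSub (lin g) ^ (e + 1)) B = F)
    (n : ℤ) : cf n (A (-1) - B (-1)) = - moment 1 g e F n := by
  have hpow : ∀ k : ℕ, UnifBdd ((shiftSub (lin g) ^ k) A) ∧ IdxBdd ((shiftSub (lin g) ^ k) B) := by
    intro k
    induction k with
    | zero => exact ⟨hA, hB⟩
    | succ k ih =>
      rw [pow_succ', Module.End.mul_apply, Module.End.mul_apply]
      exact ⟨ih.1.shiftSub g, ih.2.shiftSub g⟩
  have hF1 : UnifBdd F := hFA ▸ (hpow _).1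
  have hF2 : IdxBdd F := hFB ▸ (hpow _).2
  have h1 := moment_pow_shiftSub negInd_succ UnifBdd (fun A h => h.shiftSub g)
    (fun A h => h.momentFinite g) hA e n
  have h2 := moment_pow_shiftSub nonnegInd_succ IdxBdd (fun A h => h.shiftSub g)
    (fun A h => h.momentFinite g) hB e n
  rw [hFA] at h1
  rw [hFB] at h2
  -- The full moment of `F` splits at `m = 0`. The negative half is computed from `A`, with jump
  -- `-1`, and the nonnegative half from `B`, with jump `1`.
  rw [← moment_negInd_add_nonnegInd g hF1 hF2, h1, h2, map_sub]
  simp [negInd, nonnegInd]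
  abel

/-- Let `A` and `B` be expansions in different regions of the same series with a pole of order `k`
at `x₁ = g(x₂)`, and let `Y` be its Laurent expansion at this pole. Then `A - B` is minus the
combination of delta functions given by `Y`. -/
theorem sub_add_deltaSum_eq_zero {A B Y : ℤ → InfModule W} (g : LinPoly) (hA : UnifBdd A)
    (hB : IdxBdd B) {J : ℕ} (hY : Y ∈ vanishBelow LaurentField (InfModule W) J) (k : ℕ)
    (hAB : (shiftSub (lin g) ^ k) A = (shiftSub (lin g) ^ k) B)
    (hYneg : ∀ i : ℤ, i < 0 → Y (i - k) = 0)
    (hYF : ∀ (i : ℕ) (n : ℤ), cf n (Y (i - k)) = moment 1 g i ((shiftSub (lin g) ^ k) A) n) :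
    A - B + deltaSum (lin g) J Y = 0 := by
  have hg := lin_ne_zero g
  have hD : ∀ j : ℕ, (shiftSub (lin g) ^ j) (deltaSum (lin g) J Y)
      = deltaSum (lin g) J (fun i => Y (i - j)) := fun j => by
    rw [shiftSub_pow, ← (deltaSum_aeval hg J _ hY).2, aeval_shiftAdd_X_sub_C_pow]
    congr 1
    funext i
    exact shift_pow_apply j Y i
  apply eq_zero_of_moments hg k
  · rw [← shiftSub_pow, map_add, map_sub, hAB, sub_self, zero_add, hD]
    exact deltaSum_eq_zero _ _ fun i hi => hYneg i hi
  · intro j hj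
    -- After `j` factors the pole has order `e + 1`, the form needed for the residue comparison.
    obtain ⟨e, rfl⟩ : ∃ e, k = j + (e + 1) := ⟨k - j - 1, by omega⟩
    have hpow : ∀ k : ℕ,
        UnifBdd ((shiftSub (lin g) ^ k) A) ∧ IdxBdd ((shiftSub (lin g) ^ k) B) := by
      intro k
      induction k with
      | zero => exact ⟨hA, hB⟩
      | succ k ih =>
        rw [pow_succ', Module.End.mul_apply, Module.End.mul_apply]
        exact ⟨ih.1.shiftSub g, ih.2.shiftSub g⟩
    have hFA : (shiftSub (lin g) ^ (e + 1)) ((shiftSub (lin g) ^ j) A)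
        = (shiftSub (lin g) ^ (j + (e + 1))) A := by
      rw [← Module.End.mul_apply, ← pow_add, add_comm]
    have hFB : (shiftSub (lin g) ^ (e + 1)) ((shiftSub (lin g) ^ j) B)
        = (shiftSub (lin g) ^ (j + (e + 1))) A := by
      rw [hAB, ← Module.End.mul_apply, ← pow_add, add_comm]
    rw [← shiftSub_pow, map_add, map_sub, hD, Pi.add_apply, deltaSum_neg_one]
    · refine ext_cf fun n => ?_
      rw [map_add, Pi.sub_apply, cf_residue_sub g (hpow j).1 (hpow j).2 e hFA hFB, ← hYF e n]
      -- The Taylor coefficient of order `e` of `(x - g) ^ k A` is the Laurent coefficient of order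
      -- `e - k = -1 - j`.
      have : (e : ℤ) - ((j + (e + 1) : ℕ) : ℤ) = -1 - j := by push_cast; ring
      rw [this, neg_add_cancel, map_zero]
    · intro i hi
      exact hY _ (by omega)

/-! ### The rows of a series in two variables -/

/-- A series in two variables as a sequence of series in the second variable. -/
def rows (A : ℤ → ℤ → W) (m : ℤ) : InfModule W := ofFun (A m)

theorem cf_rows {A : ℤ → ℤ → W} (hA : A ∈ rowBdd W) (m n : ℤ) : cf n (rows A m) = A m n :=
  cf_ofFun (hA m) n

theorem rows_factor {A : ℤ → ℤ → W} (hA : A ∈ rowBdd W) (h : LinPoly) :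
    rows (op W h.factor A) = aeval (shift LaurentField _) (X - C (lin h)) (rows A) := by
  funext m
  refine ext_cf fun n => ?_
  rw [cf_rows (op_mem_rowBdd _ hA), op_factor]
  change _ = cf n (shiftSub (lin h) (rows A) m)
  rw [shiftSub_apply, map_sub, cf_lin_smul, cf_rows hA, cf_rows hA, cf_rows hA]

theorem rows_prod_factor {A : ℤ → ℤ → W} (hA : A ∈ rowBdd W) (s : Multiset LinPoly) :
    rows (op W (s.map LinPoly.factor).prod A)
      = aeval (shift LaurentField _) (s.map fun h => X - C (lin h)).prod (rows A) := by
  induction s using Multiset.induction_on with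
  | empty => simp
  | cons h s ih =>
    rw [Multiset.map_cons, Multiset.prod_cons, Multiset.map_cons, Multiset.prod_cons, op_mul,
      rows_factor (op_mem_rowBdd _ hA), ih, map_mul, Module.End.mul_apply]

theorem unifBdd_rows {A : ℤ → ℤ → W} (hA : A ∈ sndBdd W) : UnifBdd (rows A) := by
  obtain ⟨N, hN⟩ := hA
  refine ⟨N, fun m n hn => ?_⟩
  rw [rows, cf_ofFun ⟨N, hN m⟩, hN m n hn]

theorem idxBdd_rows {A : ℤ → ℤ → W} (hA : A ∈ fstBdd W) : IdxBdd (rows A) := by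
  obtain ⟨N, hN⟩ := hA
  refine ⟨N, fun m hm => ext_cf fun n => ?_⟩
  rw [rows, cf_ofFun ⟨0, fun n _ => hN m n hm⟩, hN m n hm, map_zero]

/-- The Taylor coefficients of `F(g(x₂ + x₀), x₂)`. -/
theorem substAdd_substFirst (g : LinPoly) {F : ℤ → ℤ → W} (hF : F ∈ trunc W) (i : ℕ) (n : ℤ) :
    substAdd (substFirst g F) i n = ((g.a : ℂ) ^ i) • moment 1 g i (rows F) n := by
  have hrow := trunc_le_rowBdd hF
  obtain ⟨N, hN⟩ := hF
  rw [substAdd, if_pos (by omega), Int.toNat_natCast, moment]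
  -- A nonzero term has `l ≤ k`, `k ≤ N` and `n + i - l ≤ N`. Hence both indices lie in `[n + i - N,
  -- N]`, and the two sums can be exchanged.
  have inner1 : ∀ l : ℤ, substFirst g F l (n + i - l)
      = ∑ k ∈ Finset.Icc (n + i - N) N,
        (LaurentInf.linPow g k).1 l • F k (n + i - l) := fun l => by
    rw [substFirst]
    refine finsum_eq_sum_of_support_subset _ fun k hk => ?_
    rw [Finset.coe_Icc, Set.mem_Icc]
    by_contra hc
    apply hk
    rcases lt_or_ge k l with h | h
    · simp only [linPow_eq_zero g h, zero_smul]
    · simp only [hN k (n + i - l) (by omega), smul_zero]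
  have inner2 : ∀ k : ℤ, cf n (lin g ^ (k - i) • rows F k)
      = ∑ l ∈ Finset.Icc (n + i - N) N,
        (LaurentInf.linPow g (k - i)).1 (l - i) • F k (n + i - l) := fun k => by
    rw [cf_lin_zpow_smul, ← finsum_comp_equiv (Equiv.subRight (i : ℤ)),
      finsum_eq_sum_of_support_subset (s := Finset.Icc (n + i - N) N)]
    · refine Finset.sum_congr rfl fun l _ => ?_
      rw [Equiv.subRight_apply, cf_rows hrow]
      congr 2; ring
    · intro l hl
      rw [Finset.coe_Icc, Set.mem_Icc]
      by_contra hc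
      apply hl
      have e : n - (l - (i : ℤ)) = n + i - l := by ring
      simp only [Equiv.subRight_apply, cf_rows hrow, e]
      rcases lt_or_ge k l with h | h
      · rw [linPow_eq_zero g (by omega), zero_smul]
      · rw [hN k (n + i - l) (by omega), smul_zero]
  simp only [inner1, inner2, Pi.one_apply, one_mul]
  rw [finsum_eq_sum_of_support_subset (s := Finset.Icc (n + i - N) N),
    finsum_eq_sum_of_support_subset (s := Finset.Icc (n + i - N) N)]
  · simp only [Finset.smul_sum, smul_smul]
    rw [Finset.sum_comm]
    refine Finset.sum_congr rfl fun k _ => Finset.sum_congr rfl fun l _ => ?_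
    rw [choose_mul_linPow]
    congr 1; ring
  · intro k hk
    rw [Finset.coe_Icc, Set.mem_Icc]
    by_contra hc
    apply hk
    have : ∑ l ∈ Finset.Icc (n + i - N) N,
        (LaurentInf.linPow g (k - i)).1 (l - i) • F k (n + i - l) = 0 := by
      refine Finset.sum_eq_zero fun l hl => ?_
      rcases lt_or_ge k l with h | h
      · rw [linPow_eq_zero g (by omega), zero_smul]
      · rw [hN k _ (by omega), smul_zero]
    simp only [this, smul_zero]
  · intro l hl
    rw [Finset.coe_Icc, Set.mem_Icc]
    by_contra hc
    apply hl
    have : ∑ k ∈ Finset.Icc (n + i - N) N,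
        (LaurentInf.linPow g k).1 l • F k (n + i - l) = 0 := by
      refine Finset.sum_eq_zero fun k hk => ?_
      rw [Finset.mem_Icc] at hk
      rcases lt_or_ge k l with h | h
      · rw [linPow_eq_zero g h, zero_smul]
      · rw [hN k _ (by omega), smul_zero]
    simp only [this, smul_zero]

end InfSeries

/-! ### The commutator formula -/

theorem VertexAlgebra.exists_nprod_eq_zero {V : Type*} [AddCommGroup V] [Module ℂ V]
    (A : VertexAlgebra V) (u v : V) : ∃ J : ℕ, ∀ n : ℤ, (J : ℤ) ≤ n → A.nprod u n v = 0 := by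
  refine ⟨(-(HahnSeries.order ((HahnModule.of ℂ).symm (A.Y u v)))).toNat, fun n hn => ?_⟩
  apply VertexOperator.ncoeff_eq_zero_of_lt_order
  omega

namespace InfSeries

open ShiftSeq BiSeries Polynomial

variable {W : Type*} [AddCommGroup W] [Module ℂ W]

/-- The sequence of the coefficients of `Y(x₀ / a, x₂)` in powers of `x₀`, where `g = a x + b`. -/
def scaledRows (g : LinPoly) (Y : ℤ → ℤ → W) (i : ℤ) : InfModule W :=
  const ((g.a : ℂ) ^ (-i)) • rows Y i

theorem scaledRows_mem {g : LinPoly} {Y : ℤ → ℤ → W} {J : ℕ}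
    (h : ∀ i : ℤ, i < -(J : ℤ) → Y i = 0) :
    scaledRows g Y ∈ vanishBelow LaurentField (InfModule W) J := by
  intro i hi
  have : rows Y i = 0 := ext_cf fun n => by
    rw [rows, h i hi, cf_ofFun (f := (0 : ℤ → W)) ⟨0, fun _ _ => rfl⟩, map_zero]; rfl
  rw [scaledRows, this, smul_zero]

theorem op_shiftFirst_linFactor (g h : LinPoly) (Y : ℤ → ℤ → W) (i n : ℤ) :
    op W (linFactor g h).shiftFirst Y i n
      = (g.a : ℂ) • (Y (i - 1) n + Y i (n - 1)) + g.b • Y i n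
        - ((h.a : ℂ) • Y i (n - 1) + h.b • Y i n) := by
  have e : (linFactor g h).shiftFirst = MvPolynomial.C (g.a : ℂ) * (MvPolynomial.X 0 +
      MvPolynomial.X 1) + MvPolynomial.C g.b
      - (MvPolynomial.C (h.a : ℂ) * MvPolynomial.X 1 + MvPolynomial.C h.b) := by
    simp [linFactor, MvPolynomial.shiftFirst]
  rw [e, map_sub, LinearMap.sub_apply, op_add, op_add, op_mul, op_mul, op_C, op_C, op_C, op_C,
    op_add]
  simp only [Pi.sub_apply, Pi.add_apply, Pi.smul_apply, op_X0, op_X1]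

/-- Since `g(x₂ + x₀) = g(x₂) + a x₀`, the rescaling makes `a x₀` the new variable, and `g(x₂ + x₀)
- h(x₂)` becomes this variable plus `g(x₂) - h(x₂)`. -/
theorem scaledRows_linFactor (g h : LinPoly) {Y : ℤ → ℤ → W} (hY : Y ∈ rowBdd W) :
    scaledRows g (op W (linFactor g h).shiftFirst Y)
      = aeval (shiftAdd (lin g)) (X - C (lin h)) (scaledRows g Y) := by
  have ha : (g.a : ℂ) ≠ 0 := g.a.ne_zero
  funext i
  refine ext_cf fun n => ?_
  simp only [map_sub, aeval_X, aeval_C, LinearMap.sub_apply, Module.algebraMap_end_apply,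
    Pi.sub_apply, shiftAdd_apply, Pi.smul_apply, map_add, scaledRows, cf_lin_smul, cf_const_smul,
    cf_rows hY, cf_rows (op_mem_rowBdd _ hY), op_shiftFirst_linFactor]
  have e : -(i - 1) = -i + 1 := by ring
  rw [e, zpow_add_one₀ ha]
  module

theorem scaledRows_prod (g : LinPoly) (s : Multiset LinPoly) {Y : ℤ → ℤ → W}
    (hY : Y ∈ rowBdd W) :
    scaledRows g (op W (s.map (linFactor g)).prod.shiftFirst Y)
      = aeval (shiftAdd (lin g)) (s.map fun h => X - C (lin h)).prod (scaledRows g Y) := by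
  induction s using Multiset.induction_on with
  | empty =>
    have : (1 : MvPolynomial (Fin 2) ℂ).shiftFirst = 1 := map_one _
    simp [this]
  | cons h s ih =>
    rw [Multiset.map_cons, Multiset.prod_cons, Multiset.map_cons, Multiset.prod_cons,
      shiftFirst_mul, op_mul, scaledRows_linFactor g h (op_mem_rowBdd _ hY), ih, map_mul,
      Module.End.mul_apply]

end InfSeries

namespace GammaQuasiModuleAtInf

open ShiftSeq BiSeries InfSeries Polynomial

variable {Γ : Type*} [Group Γ] {V : Type*} [AddCommGroup V] [Module ℂ V]
  {A : VertexGammaAlgebra Γ V} {W : Type*} [AddCommGroup W] [Module ℂ W]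

/-- The series `Y_W(u, x₁) Y_W(v, x₂) w`. -/
def prodVec (M : GammaQuasiModuleAtInf A W) (u v : V) (w : W) (m n : ℤ) : W :=
  (M.YW u).1 m ((M.YW v).1 n w)

/-- The series `Y_W(v, x₂) Y_W(u, x₁) w`. -/
def revVec (M : GammaQuasiModuleAtInf A W) (u v : V) (w : W) (m n : ℤ) : W :=
  (M.YW v).1 n ((M.YW u).1 m w)

/-- The series `Y_W(Y(u, x₀) v, x₂) w`. -/
def iterVec (M : GammaQuasiModuleAtInf A W) (u v : V) (w : W) (i k : ℤ) : W :=
  (M.YW (A.nprod u (-i - 1) v)).1 k w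

variable (M : GammaQuasiModuleAtInf A W) (u v : V) (w : W)

theorem prodVec_mem_sndBdd : M.prodVec u v w ∈ sndBdd W := by
  obtain ⟨N, hN⟩ := (M.YW v).2 w
  exact ⟨N, fun m n hn => by rw [prodVec, hN n hn, map_zero]⟩

theorem prodVec_mem_rowBdd : M.prodVec u v w ∈ rowBdd W := fun m => by
  obtain ⟨N, hN⟩ := (M.YW v).2 w
  exact ⟨N, fun n hn => by rw [prodVec, hN n hn, map_zero]⟩

theorem prodVec_mem_colBdd : M.prodVec u v w ∈ colBdd W := fun n =>
  (M.YW u).2 ((M.YW v).1 n w)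

theorem revVec_mem_fstBdd : M.revVec u v w ∈ fstBdd W := by
  obtain ⟨N, hN⟩ := (M.YW u).2 w
  exact ⟨N, fun m n hn => by rw [revVec, hN m hn, map_zero]⟩

theorem revVec_mem_rowBdd : M.revVec u v w ∈ rowBdd W := fun m =>
  (M.YW v).2 ((M.YW u).1 m w)

theorem iterVec_eq_zero {J : ℕ} (hJ : ∀ n : ℤ, (J : ℤ) ≤ n → A.nprod u n v = 0) (i : ℤ)
    (hi : i < -(J : ℤ)) : M.iterVec u v w i = 0 := by
  funext k
  rw [iterVec, hJ _ (by omega), map_zero]; rfl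

theorem iterVec_mem_lowBdd : M.iterVec u v w ∈ lowBdd W := by
  obtain ⟨J, hJ⟩ := A.exists_nprod_eq_zero u v
  exact ⟨⟨J, M.iterVec_eq_zero u v w hJ⟩, fun i => (M.YW (A.nprod u (-i - 1) v)).2 w⟩

/-- Covariance in the form used: the pole at `Ψ(σ)⁻¹(x₂)` for `u` is moved to `x₁ = x₂` for `L(σ)u`.
-/
theorem prodVec_L (σ : Γ) :
    M.prodVec (A.L σ u) v w = substFirst (M.Ψ σ)⁻¹ (M.prodVec u v w) := by
  funext m n
  rw [prodVec, M.covariance]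
  rfl

theorem phi_inv (σ : Γ) : ((A.φ σ : ℂ))⁻¹ = (((M.Ψ σ)⁻¹).a : ℂ) := by
  rw [M.φ_eq]
  simp [LinPoly.leading]

variable {u v w}

theorem op_prodVec_eq {s : Multiset LinPoly}
    (hs : Series₂.polyMul (s.map LinPoly.factor).prod (FieldAtInf.comm₂ (M.YW u) (M.YW v)) = 0) :
    op W (s.map LinPoly.factor).prod (M.prodVec u v w)
      = op W (s.map LinPoly.factor).prod (M.revVec u v w) := by
  rw [← sub_eq_zero, ← map_sub]
  funext m n
  have h := congrArg (fun B : Series₂ W => B m n w) hs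
  simp only [polyMul_apply] at h
  exact h

/-- One side of the locality relation bounds the powers of `x₂`, the other those of `x₁`. -/
theorem op_prodVec_mem_trunc {s : Multiset LinPoly}
    (hs : op W (s.map LinPoly.factor).prod (M.prodVec u v w)
      = op W (s.map LinPoly.factor).prod (M.revVec u v w)) :
    op W (s.map LinPoly.factor).prod (M.prodVec u v w) ∈ trunc W :=
  mem_trunc_of_mem (hs ▸ op_mem_fstBdd _ (M.revVec_mem_fstBdd u v w))
    (op_mem_sndBdd _ (M.prodVec_mem_sndBdd u v w))

/-- Associativity with the polynomial that gives locality. -/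
theorem op_iterVec {s : Multiset LinPoly}
    (hs : op W (s.map LinPoly.factor).prod (M.prodVec u v w)
      = op W (s.map LinPoly.factor).prod (M.revVec u v w)) (σ : Γ) :
    op W (s.map (linFactor (M.Ψ σ)⁻¹)).prod.shiftFirst (M.iterVec (A.L σ u) v w)
      = substAdd (substFirst (M.Ψ σ)⁻¹ (op W (s.map LinPoly.factor).prod (M.prodVec u v w))) := by
  have hF := M.op_prodVec_mem_trunc hs
  set F := op W (s.map LinPoly.factor).prod (M.prodVec u v w) with hFdef
  set g := (M.Ψ σ)⁻¹
  set q := (s.map (linFactor g)).prod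
  obtain ⟨p, hp, htr, hsub⟩ := M.weak_assoc (A.L σ u) v
  have hG : op W p (M.prodVec (A.L σ u) v w) ∈ trunc W := by
    obtain ⟨N, hN⟩ := htr w
    refine ⟨N, fun m n h => ?_⟩
    rw [← hN m n h, polyMul_apply]
    rfl
  have hGsub : substAdd (op W p (M.prodVec (A.L σ u) v w))
      = op W p.shiftFirst (M.iterVec (A.L σ u) v w) := by
    funext i k
    have h := hsub i k w
    rw [polyMul_apply] at h
    refine Eq.trans ?_ h
    simp only [substAdd, Series₂.substAdd, polyMul_apply]
    rfl
  have hqG : op W q (op W p (M.prodVec (A.L σ u) v w)) = op W p (substFirst g F) := by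
    rw [← op_mul, mul_comm, op_mul, prodVec_L, hFdef,
      substFirst_prod_factor g s (M.prodVec_mem_colBdd u v w)]
  -- The polynomial `p` of weak associativity is arbitrary. Applying both `p` and `q` gives two
  -- expressions for the same series, and then `p(x₀ + x₂, x₂)` is cancelled in `W((x₂⁻¹))((x₀))`,
  -- leaving only `q`.
  have hcancel : op W p.shiftFirst (op W q.shiftFirst (M.iterVec (A.L σ u) v w)
      - substAdd (substFirst g F)) = 0 := by
    rw [map_sub, ← substAdd_op p (substFirst_mem_trunc g hF), ← hqG, substAdd_op q hG, hGsub,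
      ← op_mul, ← op_mul, mul_comm, sub_self]
  exact sub_eq_zero.1 (eq_zero_of_op_eq_zero (shiftFirst_ne_zero hp)
    (Submodule.sub_mem _ (op_mem_lowBdd _ (M.iterVec_mem_lowBdd _ v w))
      (substAdd_mem_lowBdd (substFirst_mem_trunc g hF))) hcancel)

theorem aeval_scaledRows_iterVec {s : Multiset LinPoly}
    (hs : op W (s.map LinPoly.factor).prod (M.prodVec u v w)
      = op W (s.map LinPoly.factor).prod (M.revVec u v w)) (σ : Γ) :
    aeval (shiftAdd (lin (M.Ψ σ)⁻¹)) (s.map fun h => X - C (lin h)).prod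
        (scaledRows (M.Ψ σ)⁻¹ (M.iterVec (A.L σ u) v w))
      = scaledRows (M.Ψ σ)⁻¹ (substAdd (substFirst (M.Ψ σ)⁻¹
          (op W (s.map LinPoly.factor).prod (M.prodVec u v w)))) := by
  rw [← op_iterVec M hs, scaledRows_prod _ _ (M.iterVec_mem_lowBdd _ v w).2]

/-- `F(g(x₂ + x₀), x₂)` is a power series in `x₀`: the locality polynomial clears the whole polar
part. -/
theorem aeval_scaledRows_iterVec_neg {s : Multiset LinPoly}
    (hs : op W (s.map LinPoly.factor).prod (M.prodVec u v w)
      = op W (s.map LinPoly.factor).prod (M.revVec u v w)) (σ : Γ) (i : ℤ) (hi : i < 0) :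
    aeval (shiftAdd (lin (M.Ψ σ)⁻¹)) (s.map fun h => X - C (lin h)).prod
        (scaledRows (M.Ψ σ)⁻¹ (M.iterVec (A.L σ u) v w)) i = 0 := by
  rw [aeval_scaledRows_iterVec M hs]
  refine scaledRows_mem (J := 0) (fun i hi => ?_) i (by simpa using hi)
  funext k
  rw [substAdd, if_neg (by simpa using hi)]; rfl

/-- The factor `a ^ i` from the Taylor expansion of `F(g(x₂ + x₀), x₂)` cancels the `a ^ (-i)` of
the rescaling. -/
theorem cf_aeval_scaledRows_iterVec {s : Multiset LinPoly}
    (hs : op W (s.map LinPoly.factor).prod (M.prodVec u v w)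
      = op W (s.map LinPoly.factor).prod (M.revVec u v w)) (σ : Γ) (i : ℕ) (n : ℤ) :
    cf n (aeval (shiftAdd (lin (M.Ψ σ)⁻¹)) (s.map fun h => X - C (lin h)).prod
        (scaledRows (M.Ψ σ)⁻¹ (M.iterVec (A.L σ u) v w)) i)
      = moment 1 (M.Ψ σ)⁻¹ i
          (rows (op W (s.map LinPoly.factor).prod (M.prodVec u v w))) n := by
  have hF := M.op_prodVec_mem_trunc hs
  have ha : (((M.Ψ σ)⁻¹).a : ℂ) ≠ 0 := Units.ne_zero _
  rw [aeval_scaledRows_iterVec M hs, scaledRows, cf_const_smul,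
    cf_rows (substAdd_mem_lowBdd (substFirst_mem_trunc _ hF)).2, substAdd_substFirst _ hF,
    smul_smul, ← zpow_natCast, ← zpow_add₀ ha, neg_add_cancel, zpow_zero, one_smul]

/-- The commutator and the delta functions at one of the roots agree after multiplication by the
factors at the other roots. -/
theorem aeval_sub_add_deltaSum {s s' : Multiset LinPoly} {k : ℕ} {σ : Γ}
    (hss : s = Multiset.replicate k (M.Ψ σ)⁻¹ + s')
    (hs : op W (s.map LinPoly.factor).prod (M.prodVec u v w)
      = op W (s.map LinPoly.factor).prod (M.revVec u v w)) {J : ℕ}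
    (hJ : ∀ n : ℤ, (J : ℤ) ≤ n → A.nprod (A.L σ u) n v = 0) :
    aeval (shift LaurentField _) (s'.map fun h => X - C (lin h)).prod
      (rows (M.prodVec u v w) - rows (M.revVec u v w)
        + deltaSum (lin (M.Ψ σ)⁻¹) J (scaledRows (M.Ψ σ)⁻¹ (M.iterVec (A.L σ u) v w))) = 0 := by
  set g := (M.Ψ σ)⁻¹ with hg
  set Y := scaledRows g (M.iterVec (A.L σ u) v w) with hYdef
  set Q := (s'.map fun h => X - C (lin h)).prod with hQ
  have hQs : (s.map fun h => X - C (lin h)).prod = (X - C (lin g)) ^ k * Q := by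
    rw [hss, Multiset.map_add, Multiset.prod_add, Multiset.map_replicate, Multiset.prod_replicate]
  have hYmem : Y ∈ vanishBelow LaurentField (InfModule W) J :=
    scaledRows_mem (M.iterVec_eq_zero _ v w hJ)
  have hA : (shiftSub (lin g) ^ k) (aeval (shift LaurentField _) Q (rows (M.prodVec u v w)))
      = rows (op W (s.map LinPoly.factor).prod (M.prodVec u v w)) := by
    rw [shiftSub_pow, ← Module.End.mul_apply, ← map_mul, ← hQs,
      rows_prod_factor (M.prodVec_mem_rowBdd u v w)]
  have hB : (shiftSub (lin g) ^ k) (aeval (shift LaurentField _) Q (rows (M.revVec u v w)))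
      = rows (op W (s.map LinPoly.factor).prod (M.revVec u v w)) := by
    rw [shiftSub_pow, ← Module.End.mul_apply, ← map_mul, ← hQs,
      rows_prod_factor (M.revVec_mem_rowBdd u v w)]
  have hYk : ∀ i : ℤ, aeval (shiftAdd (lin g)) Q Y (i - k)
      = aeval (shiftAdd (lin g)) (s.map fun h => X - C (lin h)).prod Y i := fun i => by
    rw [hQs, map_mul, Module.End.mul_apply, aeval_shiftAdd_X_sub_C_pow, shift_pow_apply]
  obtain ⟨hQY, hdQ⟩ := deltaSum_aeval (lin_ne_zero g) J Q hYmem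
  -- Applying `Q` to `A`, `B` and `Y` alike leaves `g` as the only pole to be compared, of order at
  -- most `k`.
  rw [map_add, map_sub, ← hdQ]
  refine sub_add_deltaSum_eq_zero g ?_ ?_ hQY k ?_ ?_ ?_
  · rw [hQ, ← rows_prod_factor (M.prodVec_mem_rowBdd u v w)]
    exact unifBdd_rows (op_mem_sndBdd _ (M.prodVec_mem_sndBdd u v w))
  · rw [hQ, ← rows_prod_factor (M.revVec_mem_rowBdd u v w)]
    exact idxBdd_rows (op_mem_fstBdd _ (M.revVec_mem_fstBdd u v w))
  · rw [hA, hB, hs]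
  · intro i hi
    rw [hYk]
    exact M.aeval_scaledRows_iterVec_neg hs σ i hi
  · intro i n
    rw [hYk, hA]
    exact M.cf_aeval_scaledRows_iterVec hs σ i n

variable (u v w)

theorem rows_iterVec (j : ℕ) :
    rows (M.iterVec u v w) (-(j : ℤ) - 1) = vec (M.YW (A.nprod u j v)) w := by
  rw [rows, vec]
  congr 1
  funext n
  have e : -(-(j : ℤ) - 1) - 1 = j := by ring
  rw [iterVec, e]

/-- At index `-j - 1` the rescaling is `a ^ (1 + j)`: one factor is `φ(σ)⁻¹`, and `a ^ j` is the
chain rule factor of `mulDelta_apply`. -/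
theorem commTerm_apply (σ : Γ) (j : ℕ) (m n : ℤ) :
    M.commTerm u v σ j m n w = cf n (deltaTerm (lin (M.Ψ σ)⁻¹) j
      (scaledRows (M.Ψ σ)⁻¹ (M.iterVec (A.L σ u) v w) (-(j : ℤ) - 1)) m) := by
  change ((A.φ σ : ℂ))⁻¹ • FieldAtInf.mulDelta _ j (M.Ψ σ)⁻¹ m n w = _
  have ha : (((M.Ψ σ)⁻¹).a : ℂ) ≠ 0 := Units.ne_zero _
  have e : -(-(j : ℤ) - 1) = 1 + j := by ring
  rw [M.phi_inv, mulDelta_apply, scaledRows, rows_iterVec, e, zpow_add₀ ha, zpow_one, zpow_natCast,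
    map_mul, mul_smul]
  simp only [map_smul, Pi.smul_apply, cf_const_smul]

theorem commTerm_eq_zero_of_le {σ : Γ} {J : ℕ}
    (hJ : ∀ n : ℤ, (J : ℤ) ≤ n → A.nprod (A.L σ u) n v = 0) {j : ℕ} (hj : J ≤ j) :
    M.commTerm u v σ j = 0 := by
  funext m n
  ext w
  rw [commTerm_apply, scaledRows_mem (M.iterVec_eq_zero _ v w hJ) _ (by omega), map_zero,
    Pi.zero_apply, map_zero]
  rfl

theorem finsum_commTerm {σ : Γ} {J : ℕ}
    (hJ : ∀ n : ℤ, (J : ℤ) ≤ n → A.nprod (A.L σ u) n v = 0) :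
    ∑ᶠ j : ℕ, M.commTerm u v σ j = ∑ j ∈ Finset.range J, M.commTerm u v σ j := by
  refine finsum_eq_sum_of_support_subset _ fun j hj => ?_
  rw [Finset.coe_range, Set.mem_Iio]
  by_contra hc
  exact hj (M.commTerm_eq_zero_of_le u v hJ (by omega))

theorem sum_commTerm_apply (σ : Γ) (J : ℕ) (m n : ℤ) :
    (∑ j ∈ Finset.range J, M.commTerm u v σ j) m n w = cf n (deltaSum (lin (M.Ψ σ)⁻¹) J
      (scaledRows (M.Ψ σ)⁻¹ (M.iterVec (A.L σ u) v w)) m) := by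
  rw [deltaSum_apply, Finset.sum_apply, Finset.sum_apply, Finset.sum_apply, LinearMap.sum_apply,
    map_sum]
  exact Finset.sum_congr rfl fun j _ => M.commTerm_apply u v w σ j m n

/-- There is no contribution from the elements that are not roots of a polynomial giving
locality. -/
theorem commTerm_eq_zero {s : Multiset LinPoly}
    (hs : Series₂.polyMul (s.map LinPoly.factor).prod (FieldAtInf.comm₂ (M.YW u) (M.YW v)) = 0)
    {σ : Γ} (hσ : (M.Ψ σ)⁻¹ ∉ s) (j : ℕ) : M.commTerm u v σ j = 0 := by
  funext m n
  ext w
  obtain ⟨J, hJ⟩ := A.exists_nprod_eq_zero (A.L σ u) v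
  have h := neg_part_eq_zero_of_prod (g := lin (M.Ψ σ)⁻¹) (s.map lin)
    (fun h hh e => by
      obtain ⟨x, hx, rfl⟩ := Multiset.mem_map.1 hh
      exact hσ (lin_injective e ▸ hx))
    (scaledRows_mem (g := (M.Ψ σ)⁻¹) (M.iterVec_eq_zero _ v w hJ))
    (fun i hi => by
      rw [Multiset.map_map]
      exact M.aeval_scaledRows_iterVec_neg (M.op_prodVec_eq hs) σ i hi)
  rw [commTerm_apply, h _ (by omega), map_zero, Pi.zero_apply, map_zero]
  rfl

open Classical in
/-- The commutator formula for a set of roots whose powers give locality. -/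
theorem comm_eq_neg_sum (t : Finset LinPoly) (N : ℕ)
    (hs : Series₂.polyMul ((N • t.val).map LinPoly.factor).prod
      (FieldAtInf.comm₂ (M.YW u) (M.YW v)) = 0)
    (σ : LinPoly → Γ) (hσ : ∀ g ∈ t, (M.Ψ (σ g))⁻¹ = g) {J : ℕ} (hJN : J ≤ N)
    (hJ : ∀ g ∈ t, ∀ n : ℤ, (J : ℤ) ≤ n → A.nprod (A.L (σ g) u) n v = 0) :
    FieldAtInf.comm₂ (M.YW u) (M.YW v)
      = -∑ g ∈ t, ∑ j ∈ Finset.range J, M.commTerm u v (σ g) j := by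
  funext m n
  ext w
  have hs' := M.op_prodVec_eq (w := w) hs
  set Δ : LinPoly → ℤ → InfModule W := fun g => deltaSum (lin (M.Ψ (σ g))⁻¹) J
    (scaledRows (M.Ψ (σ g))⁻¹ (M.iterVec (A.L (σ g) u) v w)) with hΔ
  have hmem : ∀ g ∈ t, scaledRows (M.Ψ (σ g))⁻¹ (M.iterVec (A.L (σ g) u) v w)
      ∈ vanishBelow LaurentField (InfModule W) J := fun g hg =>
    scaledRows_mem (M.iterVec_eq_zero _ v w (hJ g hg))
  have hD : rows (M.prodVec u v w) - rows (M.revVec u v w) + ∑ g ∈ t, Δ g = 0 := by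
    rcases t.eq_empty_or_nonempty with rfl | ht
    · have h1 : M.prodVec u v w = M.revVec u v w := by simpa using hs'
      rw [h1, sub_self, Finset.sum_empty, add_zero]
    -- It suffices to kill the difference by the factors at all roots other than `i`. These
    -- annihilate the commutator corrected at `i`, and also the delta functions at each other root,
    -- whose order is below `J ≤ N`.
    · refine eq_zero_of_coprime ht lin_injective N fun i hi => ?_
      have hsplit : N • t.val
          = Multiset.replicate N (M.Ψ (σ i))⁻¹ + N • (t.erase i).val := by
        rw [hσ i hi, ← Multiset.nsmul_singleton, ← nsmul_add, Multiset.singleton_add,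
          Finset.erase_val, Multiset.cons_erase hi]
      have h1 := M.aeval_sub_add_deltaSum hsplit hs' (hJ i hi)
      have hQ : ((N • (t.erase i).val).map fun h => X - C (lin h)).prod
          = ∏ l ∈ t \ {i}, (X - C (lin l)) ^ N := by
        rw [Multiset.map_nsmul, Multiset.prod_nsmul, Finset.sdiff_singleton_eq_erase,
          Finset.prod_pow]
        rfl
      rw [hQ] at h1
      rw [← Finset.add_sum_erase t Δ hi, ← add_assoc, map_add, h1, zero_add, map_sum]
      refine Finset.sum_eq_zero fun l hl => ?_
      have hlt := Finset.mem_of_mem_erase hl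
      rw [← Finset.sdiff_singleton_eq_erase] at hl
      rw [← Finset.mul_prod_erase _ _ hl, mul_comm, map_mul, Module.End.mul_apply]
      have h2 := shiftSub_pow_deltaSum (lin_ne_zero (M.Ψ (σ l))⁻¹) hJN (hmem l hlt)
      rw [hσ l hlt] at h2
      simp only [hΔ, hσ l hlt]
      rw [h2, map_zero]
  have h := congrArg (fun D : ℤ → InfModule W => cf n (D m)) hD
  simp only [Pi.add_apply, Pi.sub_apply, map_add, map_sub, Finset.sum_apply, map_sum,
    Pi.zero_apply, map_zero, cf_rows (M.prodVec_mem_rowBdd u v w),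
    cf_rows (M.revVec_mem_rowBdd u v w)] at h
  change M.prodVec u v w m n - M.revVec u v w m n
    = -((∑ g ∈ t, ∑ j ∈ Finset.range J, M.commTerm u v (σ g) j) m n w)
  rw [Finset.sum_apply, Finset.sum_apply, LinearMap.sum_apply, eq_neg_iff_add_eq_zero, ← h]
  congr 1
  exact Finset.sum_congr rfl fun g _ => M.sum_commTerm_apply u v w (σ g) J m n

end GammaQuasiModuleAtInf

end

/-! ### The theorem: choosing elements of `Γ` above the roots -/

theorem theorem2p13 {Γ : Type*} [Group Γ]
    {V : Type*} [AddCommGroup V] [Module ℂ V] (A : VertexGammaAlgebra Γ V)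
    {W : Type*} [AddCommGroup W] [Module ℂ W] (M : GammaQuasiModuleAtInf A W) (u v : V) :
    (∃ (r : ℕ) (σ : Fin r → Γ), Function.Injective (fun i => M.Ψ (σ i)) ∧
      FieldAtInf.comm₂ (M.YW u) (M.YW v)
        = -∑ i : Fin r, ∑ᶠ j : ℕ, M.commTerm u v (σ i) j) ∧
    (Function.Injective M.Ψ →
      (Function.support fun q : Γ × ℕ => M.commTerm u v q.1 q.2).Finite ∧
      FieldAtInf.comm₂ (M.YW u) (M.YW v)
        = -∑ᶠ q : Γ × ℕ, M.commTerm u v q.1 q.2) := by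
  classical
  obtain ⟨s, hsΨ, hs⟩ := M.isLocal _ ⟨u, rfl⟩ _ ⟨v, rfl⟩
  set t := s.toFinset with ht
  have hex : ∀ g : LinPoly, ∃ σ : Γ, g ∈ t → (M.Ψ σ)⁻¹ = g := fun g => by
    by_cases hg : g ∈ t
    · obtain ⟨σ, hσ⟩ := hsΨ g (Multiset.mem_toFinset.1 hg)
      -- The roots lie in the image of `Ψ`, while the formula is indexed by `Ψ(σ)⁻¹`; hence the
      -- inverse.
      exact ⟨σ⁻¹, fun _ => by rw [map_inv, inv_inv, hσ]⟩
    · exact ⟨1, fun h => absurd h hg⟩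
  choose σ hσ using hex
  choose J' hJ' using fun g : LinPoly => A.exists_nprod_eq_zero (A.L (σ g) u) v
  set J := t.sup J' with hJdef
  have hJ : ∀ g ∈ t, ∀ n : ℤ, (J : ℤ) ≤ n → A.nprod (A.L (σ g) u) n v = 0 := fun g hg n hn =>
    hJ' g n (le_trans (by exact_mod_cast Finset.le_sup (f := J') hg) hn)
  obtain ⟨N₀, hN₀⟩ := Multiset.le_smul_dedup s
  -- A common exponent for all roots: at least `N₀` to retain locality, at least `J` to kill delta
  -- functions of order below `J`.
  have hle : s ≤ (max N₀ J) • t.val :=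
    hN₀.trans (by
      rw [ht, Multiset.toFinset_val]
      exact nsmul_le_nsmul_left (Multiset.zero_le _) (le_max_left _ _))
  have hsN : Series₂.polyMul (((max N₀ J) • t.val).map LinPoly.factor).prod
      (FieldAtInf.comm₂ (M.YW u) (M.YW v)) = 0 := by
    obtain ⟨c, hc⟩ := Multiset.prod_dvd_prod_of_le (Multiset.map_le_map (f := LinPoly.factor) hle)
    funext m n
    ext w
    have h0 : BiSeries.op W (s.map LinPoly.factor).prod
        (fun m n => FieldAtInf.comm₂ (M.YW u) (M.YW v) m n w) = 0 := by
      funext m n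
      rw [← BiSeries.polyMul_apply, hs]; rfl
    rw [BiSeries.polyMul_apply, hc, mul_comm, BiSeries.op_mul, h0, map_zero]
    rfl
  have hmain := M.comm_eq_neg_sum u v t (max N₀ J) hsN σ hσ (le_max_right _ _) hJ
  have hΨσ : ∀ g ∈ t, M.Ψ (σ g) = g⁻¹ := fun g hg => by rw [← hσ g hg, inv_inv, hσ g hg]
  constructor
  · refine ⟨t.card, fun i => σ (t.equivFin.symm i), fun i j hij => ?_, ?_⟩
    · have e : ((t.equivFin.symm i : LinPoly))⁻¹ = ((t.equivFin.symm j : LinPoly))⁻¹ := by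
        rw [← hΨσ _ (t.equivFin.symm i).2, ← hΨσ _ (t.equivFin.symm j).2]
        exact hij
      exact t.equivFin.symm.injective (Subtype.ext (inv_injective e))
    · rw [hmain, Equiv.sum_comp t.equivFin.symm
        (fun g : t => ∑ᶠ j : ℕ, M.commTerm u v (σ g) j),
        Finset.sum_coe_sort t (fun g => ∑ᶠ j : ℕ, M.commTerm u v (σ g) j)]
      congr 1
      exact Finset.sum_congr rfl fun g hg => (M.finsum_commTerm u v (hJ g hg)).symm
  · intro hinj
    have hsupp : (Function.support fun q : Γ × ℕ => M.commTerm u v q.1 q.2)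
        ⊆ ((t.image σ) ×ˢ Finset.range J : Finset (Γ × ℕ)) := by
      rintro ⟨τ, j⟩ hq
      have hτ : (M.Ψ τ)⁻¹ ∈ t := by
        by_contra hc
        exact hq (M.commTerm_eq_zero u v hs (fun h => hc (Multiset.mem_toFinset.2 h)) j)
      -- Injectivity makes the chosen element over a root the only one, so no other element of `Γ`
      -- contributes.
      have hτσ : σ (M.Ψ τ)⁻¹ = τ := hinj (by rw [hΨσ _ hτ, inv_inv])
      rw [Finset.coe_product, Set.mem_prod, Finset.mem_coe, Finset.mem_coe, Finset.mem_range]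
      refine ⟨Finset.mem_image.2 ⟨_, hτ, hτσ⟩, ?_⟩
      by_contra hc
      refine hq (M.commTerm_eq_zero_of_le u v (J := J) ?_ (not_lt.1 hc))
      rw [← hτσ]
      exact hJ _ hτ
    refine ⟨(Finset.finite_toSet _).subset hsupp, ?_⟩
    rw [finsum_eq_sum_of_support_subset _ hsupp, Finset.sum_product, Finset.sum_image, hmain]
    intro g hg g' hg' e
    have := congrArg M.Ψ e
    rw [hΨσ g hg, hΨσ g' hg'] at this
    exact inv_injective this
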